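/- Let $\mathbb{D}=\{z\in\mathbb{C}:|z|<1\}$ and let $\mathbb{T}$ be the unit circle with normalized Lebesgue measure $m_{\mathbb{T}}$. Let $S_*(\mathbb{D})$ be the set of analytic functions $F$ on $\mathbb{D}$ with $|F|\le 1$ that are not finite Blaschke products (unimodular constants count as finite Blaschke products). For $F\in S_*(\mathbb{D})$ let $F_0=F$ and $$zF_{k+1}(z)=\frac{F_k(z)-F_k(0)}{1-\overline{F_k(0)}F_k(z)},\qquad k\ge 0,\ z\in\mathbb{D},$$ be the iterates of Schur's algorithm, and put $\eta(F)=\prod_{k\ge 0}(1-|F_k(0)|^2)$. The Szegő class consists of all $F\in S_*(\mathbb{D})$ with $\eta(F)>0$. Extend $F$ to almost every point of $\mathbb{T}$ by its radial boundary values and let $\hat h(k)=\int_{\mathbb{T}}h(\xi)\bar\xi^{k}\,dm_{\mathbb{T}}(\xi)$ for $h\in L^1(\mathbb{T})$, $k\in\mathbb{Z}$. For $r>0$ let $W^1(r\mathbb{T})$ be the space of $h\in L^1(\mathbb{T})$ with $\|h\|_{W^1(r\mathbb{T})}=\sum_{k\in\mathbb{Z}}r^k|\hat h(k)|<\infty$.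 Theorem. Let $F,G$ belong to the Szegő class, let $\eta(F,G)=\min(\eta(F),\eta(G))$, and let $r\in(0,1)$ satisfy $1-r\ge 12\log(\eta(F,G)^{-1})$. Then $F-G\in W^1(r\mathbb{T})$, $\|F-G\|_{W^1(r\mathbb{T})}=\sum_{k\ge 0}r^k|\hat F(k)-\hat G(k)|$, the series $\sum_{k\ge 0}r^k|F_k(0)-G_k(0)|$ converges, and $$\frac12\sum_{k=0}^{\infty}r^k|F_k(0)-G_k(0)|\ \le\ \|F-G\|_{W^1(r\mathbb{T})}\ \le\ 2\sum_{k=0}^{\infty}r^k|F_k(0)-G_k(0)|.$$ -/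

import Mathlib

open Filter Topology MeasureTheory

noncomputable section

/-- The Schur class: analytic functions on the open unit disk bounded by `1` there. Only the values
of `F` on the disk matter. -/
def IsSchur (F : ℂ → ℂ) : Prop :=
  DifferentiableOn ℂ F (Metric.ball 0 1) ∧ ∀ z ∈ Metric.ball (0 : ℂ) 1, ‖F z‖ ≤ 1

/-- `F` coincides on the unit disk with a finite Blaschke product
`c ∏ (z - a) / (1 - conj a * z)`, where `|c| = 1` and the zeros `a` (finitely many, repeated
according to multiplicity, possibly none) lie in the unit disk. -/
def IsFiniteBlaschke (F : ℂ → ℂ) : Prop :=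
  ∃ (c : ℂ) (A : Multiset ℂ), ‖c‖ = 1 ∧ (∀ a ∈ A, ‖a‖ < 1) ∧
    ∀ z ∈ Metric.ball (0 : ℂ) 1,
      F z = c * (A.map fun a => (z - a) / (1 - (starRingEnd ℂ) a * z)).prod

/-- Schur functions that are not finite Blaschke products. -/
def IsNondegSchur (F : ℂ → ℂ) : Prop :=
  IsSchur F ∧ ¬ IsFiniteBlaschke F

/-- One step `F ↦ F₁` of Schur's algorithm, `z F₁(z) = (F(z) - F(0)) / (1 - conj F(0) F(z))`.
Here `dslope F 0 z` is `(F(z) - F(0)) / z` for `z ≠ 0` and `F'(0)` for `z = 0`, so that the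
removable singularity at the origin is filled in by continuity. -/
def schurStep (F : ℂ → ℂ) : ℂ → ℂ := fun z =>
  dslope F 0 z / (1 - (starRingEnd ℂ) (F 0) * F z)

/-- The defining relation of a step of Schur's algorithm. -/
theorem mul_schurStep (F : ℂ → ℂ) (z : ℂ) :
    z * schurStep F z = (F z - F 0) / (1 - (starRingEnd ℂ) (F 0) * F z) := by
  have h : z * dslope F 0 z = F z - F 0 := by
    simpa using sub_smul_dslope F 0 z
  rw [schurStep, ← mul_div_assoc, h]

/-- The functions `F₀ = F, F₁, F₂, …` produced by Schur's algorithm. -/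
def schurIter (F : ℂ → ℂ) : ℕ → ℂ → ℂ
  | 0 => F
  | k + 1 => schurStep (schurIter F k)

/-- The recurrence coefficients `F_k(0)`. -/
def recCoeff (F : ℂ → ℂ) (k : ℕ) : ℂ := schurIter F k 0

/-- `η(F) = ∏_{k ≥ 0} (1 - |F_k(0)|²)`. For nondegenerate Schur functions all factors lie in
`(0, 1]`, so the product converges (possibly to `0`). -/
def szegoEta (F : ℂ → ℂ) : ℝ := ∏' k : ℕ, (1 - ‖recCoeff F k‖ ^ 2)

/-- The Szegő class. -/
def IsSzego (F : ℂ → ℂ) : Prop :=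
  IsNondegSchur F ∧ 0 < szegoEta F

/-- Radial boundary values `F(ξ) = lim_{ρ → 1-} F(ρ ξ)` on the unit circle, which is
parametrized by `t ↦ ξ = exp (2πi t)`, `t ∈ ℝ / ℤ`. -/
def boundaryValue (F : ℂ → ℂ) (t : UnitAddCircle) : ℂ :=
  limUnder (𝓝[<] (1 : ℝ)) fun ρ : ℝ => F ((ρ : ℂ) * (AddCircle.toCircle t : ℂ))

/-- Membership in the space `W¹(r𝕋)`: integrable functions `h` on the unit circle with
`∑_{k ∈ ℤ} r ^ k |ĥ(k)| < ∞`. The coefficients `fourierCoeff h k` are the integrals of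
`h(ξ) conj(ξ) ^ k` against normalized Lebesgue measure. -/
def MemWiener (r : ℝ) (h : UnitAddCircle → ℂ) : Prop :=
  Integrable h AddCircle.haarAddCircle ∧ Summable fun k : ℤ => r ^ k * ‖fourierCoeff h k‖

/-- The norm `∑_{k ∈ ℤ} r ^ k |ĥ(k)|` of `W¹(r𝕋)`. -/
def wienerNorm (r : ℝ) (h : UnitAddCircle → ℂ) : ℝ :=
  ∑' k : ℤ, r ^ k * ‖fourierCoeff h k‖

/-- `ρ(F, G) = ∑_{k ≥ 0} r ^ k |F_k(0) - G_k(0)|`. -/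
def recDist (r : ℝ) (F G : ℂ → ℂ) : ℝ :=
  ∑' k : ℕ, r ^ k * ‖recCoeff F k - recCoeff G k‖

end

/-! Cleared of its denominator, a step of Schur's algorithm says `φ_k = a_k + X φ_{k+1} (1 - conj
a_k φ_k)` for the Taylor series `φ_k` of `F_k`, with `a_k = F_k(0)`. To first order `φ_0` is `∑ a_k
X^k`, so the two weighted `ℓ¹` distances agree up to quadratic corrections accumulated along the
chain. Since `log (1 - x) ≤ -x`, the hypothesis gives `12 ∑ |a_k|² ≤ 1 - r`, and
`pairSum_tailSum_le` turns this into smallness of the total correction.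

All estimates concern the first `n` coefficients. Multiplication by `X` shortens the truncation by
one, so the recursion ends after `n` steps and no norm has to be known finite in advance.
`IsSchurChain.bootstrap` bounds `φ_k` by `6/5` of the tail sum of `|a_j|`. With this,
`IsSchurChain.upper_aux` and `IsSchurChain.lower_aux` compare two chains at the cost of a factor `1
- chainLoss`, which is at least `4/5`. Then `n → ∞`.

It remains to identify the Fourier coefficients of the boundary values with Taylor coefficients
(`IsSchur.fourierCoeff_boundaryValue`), by dominated convergence along dilations. Almost everywhere
existence of radial limits is proved by integrating once: a primitive of `F` is Lipschitz, hence
differentiable along almost every point of the circle, and at such a point its radial derivative,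
which is `F`, converges. -/

/-! ### Truncated weighted norms of power series -/

/-- The truncated weighted `ℓ¹` norm `∑_{k < N} r ^ k |h_k|` of a formal power series. -/
noncomputable def truncNorm (r : ℝ) (N : ℕ) (h : PowerSeries ℂ) : ℝ :=
  ∑ k ∈ Finset.range N, r ^ k * ‖PowerSeries.coeff k h‖

theorem truncNorm_nonneg {r : ℝ} (hr : 0 ≤ r) (N : ℕ) (h : PowerSeries ℂ) :
    0 ≤ truncNorm r N h :=
  Finset.sum_nonneg fun _ _ => by positivity

theorem truncNorm_zero_left (r : ℝ) (h : PowerSeries ℂ) : truncNorm r 0 h = 0 := by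
  simp [truncNorm]

theorem truncNorm_add_le {r : ℝ} (hr : 0 ≤ r) (N : ℕ) (f g : PowerSeries ℂ) :
    truncNorm r N (f + g) ≤ truncNorm r N f + truncNorm r N g := by
  rw [truncNorm, truncNorm, truncNorm, ← Finset.sum_add_distrib]
  refine Finset.sum_le_sum fun k _ => ?_
  rw [← mul_add, map_add]
  gcongr
  exact norm_add_le _ _

theorem truncNorm_neg (r : ℝ) (N : ℕ) (f : PowerSeries ℂ) :
    truncNorm r N (-f) = truncNorm r N f := by
  simp [truncNorm]

theorem truncNorm_sub_le {r : ℝ} (hr : 0 ≤ r) (N : ℕ) (f g : PowerSeries ℂ) :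
    truncNorm r N (f - g) ≤ truncNorm r N f + truncNorm r N g := by
  simpa [sub_eq_add_neg, truncNorm_neg] using truncNorm_add_le hr N f (-g)

theorem truncNorm_C_mul (r : ℝ) (N : ℕ) (a : ℂ) (f : PowerSeries ℂ) :
    truncNorm r N (PowerSeries.C a * f) = ‖a‖ * truncNorm r N f := by
  simp only [truncNorm, PowerSeries.coeff_C_mul, norm_mul, Finset.mul_sum]
  exact Finset.sum_congr rfl fun _ _ => by ring

theorem truncNorm_X_mul (r : ℝ) (N : ℕ) (f : PowerSeries ℂ) :
    truncNorm r (N + 1) (PowerSeries.X * f) = r * truncNorm r N f := by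
  rw [truncNorm, Finset.sum_range_succ', truncNorm, Finset.mul_sum]
  simp only [PowerSeries.coeff_succ_X_mul, PowerSeries.coeff_zero_X_mul, norm_zero, mul_zero,
    add_zero]
  exact Finset.sum_congr rfl fun _ _ => by ring

theorem truncNorm_C_add_X_mul (r : ℝ) (N : ℕ) (a : ℂ) (f : PowerSeries ℂ) :
    truncNorm r (N + 1) (PowerSeries.C a + PowerSeries.X * f) = ‖a‖ + r * truncNorm r N f := by
  rw [truncNorm, Finset.sum_range_succ', truncNorm, Finset.mul_sum, add_comm]
  congr 1
  · simp
  · refine Finset.sum_congr rfl fun k _ => ?_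
    simp only [map_add, PowerSeries.coeff_succ_X_mul, PowerSeries.coeff_C, Nat.succ_ne_zero,
      if_false, zero_add]
    ring

/-- The pairs of total degree below `N` form a triangle inside the square of pairs with both degrees
below `N`, and the extra terms are nonnegative. -/
theorem truncNorm_mul_le {r : ℝ} (hr : 0 ≤ r) (N : ℕ) (f g : PowerSeries ℂ) :
    truncNorm r N (f * g) ≤ truncNorm r N f * truncNorm r N g := by
  have h1 : truncNorm r N (f * g) ≤ ∑ n ∈ Finset.range N,
      ∑ p ∈ Finset.HasAntidiagonal.antidiagonal n,
      (r ^ p.1 * ‖PowerSeries.coeff p.1 f‖) * (r ^ p.2 * ‖PowerSeries.coeff p.2 g‖) := by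
    refine Finset.sum_le_sum fun n _ => ?_
    rw [PowerSeries.coeff_mul]
    refine (mul_le_mul_of_nonneg_left (norm_sum_le _ _) (by positivity)).trans ?_
    rw [Finset.mul_sum]
    refine Finset.sum_le_sum fun p hp => ?_
    rw [norm_mul, ← Finset.HasAntidiagonal.mem_antidiagonal.1 hp, pow_add]
    exact le_of_eq (by ring)
  refine h1.trans ?_
  rw [truncNorm, truncNorm, Finset.sum_mul_sum, ← Finset.sum_product', Finset.sum_sigma']
  refine le_trans (le_of_eq ?_) (Finset.sum_le_sum_of_subset_of_nonneg
    (s := (Finset.range N ×ˢ Finset.range N).filter fun p => p.1 + p.2 < N)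
    (Finset.filter_subset _ _) fun _ _ _ => by positivity)
  refine Finset.sum_bij' (fun x _ => x.2) (fun p _ => ⟨p.1 + p.2, p⟩) ?_ ?_ ?_ ?_ ?_
  · rintro ⟨n, p⟩ h
    simp only [Finset.mem_sigma, Finset.mem_range, Finset.HasAntidiagonal.mem_antidiagonal,
      Finset.mem_filter, Finset.mem_product] at h ⊢
    omega
  · rintro p h
    simp only [Finset.mem_sigma, Finset.mem_range, Finset.HasAntidiagonal.mem_antidiagonal,
      Finset.mem_filter, Finset.mem_product] at h ⊢
    exact ⟨h.2, trivial⟩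
  · rintro ⟨n, p⟩ h
    simp only [Finset.mem_sigma, Finset.HasAntidiagonal.mem_antidiagonal] at h
    obtain ⟨_, rfl⟩ := h
    rfl
  · intros; rfl
  · intros; rfl

/-! ### Geometric tail sums against sums of squares -/

/-- The truncated tail sums `∑_{j < n} r ^ j A_{k + j}`. -/
noncomputable def tailSum (r : ℝ) (A : ℕ → ℝ) (n k : ℕ) : ℝ :=
  ∑ j ∈ Finset.range n, r ^ j * A (k + j)

theorem tailSum_zero (r : ℝ) (A : ℕ → ℝ) (k : ℕ) : tailSum r A 0 k = 0 := by
  simp [tailSum]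

theorem tailSum_succ (r : ℝ) (A : ℕ → ℝ) (n k : ℕ) :
    tailSum r A (n + 1) k = A k + r * tailSum r A n (k + 1) := by
  rw [tailSum, Finset.sum_range_succ', tailSum, Finset.mul_sum, add_comm]
  congr 1
  · simp
  · refine Finset.sum_congr rfl fun j _ => ?_
    rw [show k + (j + 1) = k + 1 + j by ring]
    ring

theorem tailSum_nonneg {r : ℝ} (hr : 0 ≤ r) {A : ℕ → ℝ} (hA : ∀ k, 0 ≤ A k) (n k : ℕ) :
    0 ≤ tailSum r A n k :=
  Finset.sum_nonneg fun j _ => mul_nonneg (by positivity) (hA _)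

/-- `∑_{j < n} A_{k + j} B_{n - j, k + j}`, the sum along the sequence of a product with a
quantity depending on the remaining length. -/
noncomputable def pairSum (A : ℕ → ℝ) (B : ℕ → ℕ → ℝ) : ℕ → ℕ → ℝ
  | 0, _ => 0
  | n + 1, k => A k * B (n + 1) k + pairSum A B n (k + 1)

theorem pairSum_mono {A : ℕ → ℝ} (hA : ∀ k, 0 ≤ A k) {B C : ℕ → ℕ → ℝ} {n : ℕ}
    (h : ∀ m ≤ n, ∀ k, B m k ≤ C m k) (k : ℕ) : pairSum A B n k ≤ pairSum A C n k := by
  induction n generalizing k with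
  | zero => exact le_rfl
  | succ n ih =>
    exact add_le_add (mul_le_mul_of_nonneg_left (h _ le_rfl _) (hA k))
      (ih (fun m hm => h m (hm.trans n.le_succ)) _)

theorem pairSum_const_mul (A : ℕ → ℝ) (c : ℝ) (B : ℕ → ℕ → ℝ) (n k : ℕ) :
    pairSum A (fun m j => c * B m j) n k = c * pairSum A B n k := by
  induction n generalizing k with
  | zero => simp [pairSum]
  | succ n ih => simp only [pairSum, ih]; ring

theorem pairSum_nonneg {A : ℕ → ℝ} (hA : ∀ k, 0 ≤ A k) {B : ℕ → ℕ → ℝ}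
    (h : ∀ m k, 0 ≤ B m k) (n k : ℕ) : 0 ≤ pairSum A B n k := by
  induction n generalizing k with
  | zero => exact le_rfl
  | succ n ih => exact add_nonneg (mul_nonneg (hA k) (h _ _)) (ih _)

/-- This is the Young-type bound `∑ r^j A_i A_{i+j} ≤ (1 - r)⁻¹ ∑ A_i²`. The term `r/2 · tailSum²`
is a potential added to close the induction: when the tail changes from `P` to `a + r P`, the change
in potential absorbs the part of the new cross term not covered by `a² / (1 - r)`. -/
theorem pairSum_tailSum_le {r : ℝ} (hr0 : 0 ≤ r) (hr1 : r < 1) (A : ℕ → ℝ) (n k : ℕ) :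
    (1 - r) * (pairSum A (tailSum r A) n k + r / 2 * tailSum r A n k ^ 2) ≤
      ∑ j ∈ Finset.range n, A (k + j) ^ 2 := by
  induction n generalizing k with
  | zero => simp [pairSum, tailSum_zero]
  | succ n ih =>
    rw [pairSum, Finset.sum_range_succ', tailSum_succ]
    have h := ih (k + 1)
    have e : ∑ j ∈ Finset.range n, A (k + (j + 1)) ^ 2 =
        ∑ j ∈ Finset.range n, A (k + 1 + j) ^ 2 :=
      Finset.sum_congr rfl fun j _ => by rw [show k + (j + 1) = k + 1 + j by ring]
    rw [e, add_zero]
    generalize tailSum r A n (k + 1) = P at h ⊢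
    generalize A k = a at h ⊢
    have key : (1 - r) * (a * (a + r * P) + r / 2 * (a + r * P) ^ 2 - r / 2 * P ^ 2) ≤ a ^ 2 := by
      have h1 := mul_nonneg (mul_nonneg hr0 (sub_nonneg.2 hr1.le)) (sq_nonneg (a + r * P - P))
      linarith [sq_nonneg (a - (1 - r) * (a + r * P))]
    linarith

theorem tailSum_sq_le {r : ℝ} (hr0 : 0 ≤ r) (hr1 : r < 1) (A : ℕ → ℝ) (n k : ℕ) :
    (1 - r) * tailSum r A n k ^ 2 ≤ ∑ j ∈ Finset.range n, A (k + j) ^ 2 := by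
  induction n generalizing k with
  | zero => simp [tailSum_zero]
  | succ n ih =>
    rw [Finset.sum_range_succ', tailSum_succ]
    have h := ih (k + 1)
    have e : ∑ j ∈ Finset.range n, A (k + (j + 1)) ^ 2 =
        ∑ j ∈ Finset.range n, A (k + 1 + j) ^ 2 :=
      Finset.sum_congr rfl fun j _ => by rw [show k + (j + 1) = k + 1 + j by ring]
    rw [e, add_zero]
    generalize tailSum r A n (k + 1) = P at h ⊢
    generalize A k = a at h ⊢
    nlinarith [mul_nonneg hr0 (sq_nonneg (a - (1 - r) * P)),
      mul_nonneg (sub_nonneg.2 hr1.le) (sq_nonneg P)]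

/-! ### Formal Schur chains: a priori bounds -/

/-- Power series `φ_k` with `φ_k = a_k + X φ_{k+1} (1 - conj a_k φ_k)`: the formal version of
Schur's algorithm. -/
def IsSchurChain (φ : ℕ → PowerSeries ℂ) (a : ℕ → ℂ) : Prop :=
  ∀ k, φ k = PowerSeries.C (a k) + PowerSeries.X * φ (k + 1) *
    (1 - PowerSeries.C ((starRingEnd ℂ) (a k)) * φ k)

/-- `12 ∑ |a_k|² ≤ 1 - r`, expressed through partial sums. -/
def IsSmallSeq (r : ℝ) (a : ℕ → ℂ) : Prop :=
  ∀ n, 12 * ∑ j ∈ Finset.range n, ‖a j‖ ^ 2 ≤ 1 - r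

theorem IsSmallSeq.shift {r : ℝ} {a : ℕ → ℂ} (h : IsSmallSeq r a) (n k : ℕ) :
    12 * ∑ j ∈ Finset.range n, ‖a (k + j)‖ ^ 2 ≤ 1 - r := by
  have h1 := h (k + n)
  rw [Finset.sum_range_add] at h1
  have h2 : 0 ≤ ∑ j ∈ Finset.range k, ‖a j‖ ^ 2 := Finset.sum_nonneg fun _ _ => by positivity
  linarith

theorem IsSmallSeq.sq_le {r : ℝ} (hr0 : 0 ≤ r) {a : ℕ → ℂ} (h : IsSmallSeq r a) (k : ℕ) :
    12 * ‖a k‖ ^ 2 ≤ 1 := by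
  have := h.shift 1 k
  simp only [Finset.sum_range_one, add_zero] at this
  linarith

theorem IsSmallSeq.pairSum_le {r : ℝ} (hr0 : 0 ≤ r) (hr1 : r < 1) {a : ℕ → ℂ}
    (h : IsSmallSeq r a) (n k : ℕ) :
    12 * pairSum (fun j => ‖a j‖) (tailSum r fun j => ‖a j‖) n k ≤ 1 := by
  have h1 := pairSum_tailSum_le hr0 hr1 (fun j => ‖a j‖) n k
  have h2 := h.shift n k
  have h3 : 0 ≤ r / 2 * tailSum r (fun j => ‖a j‖) n k ^ 2 := by positivity
  have h4 : 0 < 1 - r := by linarith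
  nlinarith

theorem IsSmallSeq.tailSum_sq_le {r : ℝ} (hr0 : 0 ≤ r) (hr1 : r < 1) {a : ℕ → ℂ}
    (h : IsSmallSeq r a) (n k : ℕ) :
    12 * tailSum r (fun j => ‖a j‖) n k ^ 2 ≤ 1 := by
  have h1 := _root_.tailSum_sq_le hr0 hr1 (fun j => ‖a j‖) n k
  have h2 := h.shift n k
  have h4 : 0 < 1 - r := by linarith
  nlinarith

section Chain

variable {r : ℝ} {φ ψ : ℕ → PowerSeries ℂ} {a b : ℕ → ℂ}

theorem IsSchurChain.truncNorm_succ_le (hr0 : 0 ≤ r) (h : IsSchurChain φ a) (n k : ℕ) :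
    truncNorm r (n + 1) (φ k) ≤ ‖a k‖ + r * truncNorm r n (φ (k + 1)) +
      ‖a k‖ * (r * truncNorm r n (φ (k + 1))) * truncNorm r (n + 1) (φ k) := by
  have e : φ k = (PowerSeries.C (a k) + PowerSeries.X * φ (k + 1)) -
      PowerSeries.C ((starRingEnd ℂ) (a k)) * (PowerSeries.X * φ (k + 1) * φ k) := by
    linear_combination h k
  have h1 : truncNorm r (n + 1) (φ k) ≤
      truncNorm r (n + 1) (PowerSeries.C (a k) + PowerSeries.X * φ (k + 1)) +
      truncNorm r (n + 1)
        (PowerSeries.C ((starRingEnd ℂ) (a k)) * (PowerSeries.X * φ (k + 1) * φ k)) := by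
    conv_lhs => rw [e]
    exact truncNorm_sub_le hr0 _ _ _
  rw [truncNorm_C_add_X_mul, truncNorm_C_mul, RCLike.norm_conj] at h1
  have h2 := truncNorm_mul_le hr0 (n + 1) (PowerSeries.X * φ (k + 1)) (φ k)
  rw [truncNorm_X_mul] at h2
  have h3 := mul_le_mul_of_nonneg_left h2 (norm_nonneg (a k))
  linarith

/-- The one-step inequality contains `φ_k` on both sides, with coefficient `|a_k| ‖X φ_{k+1}‖`.
Moving it to the left costs a factor `1 - |a_k| ‖X φ_{k+1}‖` at each step, and the product of these
factors is at least one minus the sum of the losses. That sum is small only if the norms are already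
controlled, hence the joint induction with the `6/5` bound. -/
theorem IsSchurChain.bootstrap (hr0 : 0 ≤ r) (hr1 : r < 1) (h : IsSchurChain φ a)
    (ha : IsSmallSeq r a) (n : ℕ) : ∀ m ≤ n, ∀ k,
      truncNorm r m (φ k) * (1 - pairSum (fun j => ‖a j‖)
        (fun m j => r * truncNorm r (m - 1) (φ (j + 1))) m k) ≤ tailSum r (fun j => ‖a j‖) m k ∧
      truncNorm r m (φ k) ≤ 6 / 5 * tailSum r (fun j => ‖a j‖) m k := by
  have hA : ∀ k, 0 ≤ ‖a k‖ := fun k => norm_nonneg _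
  induction n with
  | zero =>
    intro m hm k
    obtain rfl : m = 0 := by omega
    simp [truncNorm_zero_left, tailSum_zero]
  | succ n ih =>
    intro m hm k
    rcases Nat.lt_or_ge m (n + 1) with h' | h'
    · exact ih m (by omega) k
    obtain rfl : m = n + 1 := by omega
    -- Even at length `n + 1` the sum involves only truncations of length at most `n`, because of
    -- the factor `X`; so the induction hypothesis applies, and `6/5 · 1/12 = 1/10`.
    have hS : ∀ p ≤ n + 1, ∀ k, pairSum (fun j => ‖a j‖)
        (fun m j => r * truncNorm r (m - 1) (φ (j + 1))) p k ≤ 1 / 10 := by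
      intro p hp k
      have h1 : pairSum (fun j => ‖a j‖) (fun m j => r * truncNorm r (m - 1) (φ (j + 1))) p k ≤
          pairSum (fun j => ‖a j‖) (fun m j => 6 / 5 * tailSum r (fun j => ‖a j‖) m j) p k := by
        refine pairSum_mono hA (fun m hm j => ?_) k
        rcases m with _ | m
        · simp [truncNorm_zero_left, tailSum_zero]
        · rw [tailSum_succ, Nat.add_sub_cancel]
          have := mul_le_mul_of_nonneg_left (ih m (by omega) (j + 1)).2 hr0
          linarith [hA j]
      rw [pairSum_const_mul _ (6 / 5)] at h1
      linarith [ha.pairSum_le hr0 hr1 p k]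
    have h0 := (ih n le_rfl (k + 1)).1
    have hs := hS n (by omega) (k + 1)
    have hs' := hS (n + 1) le_rfl k
    have step := h.truncNorm_succ_le hr0 n k
    have hs0 : 0 ≤ pairSum (fun j => ‖a j‖) (fun m j => r * truncNorm r (m - 1) (φ (j + 1)))
        n (k + 1) := pairSum_nonneg hA (fun m j => mul_nonneg hr0 (truncNorm_nonneg hr0 _ _)) _ _
    have hx := truncNorm_nonneg hr0 (n + 1) (φ k)
    have hx1 := truncNorm_nonneg hr0 n (φ (k + 1))
    have first : truncNorm r (n + 1) (φ k) * (1 - pairSum (fun j => ‖a j‖)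
        (fun m j => r * truncNorm r (m - 1) (φ (j + 1))) (n + 1) k) ≤
          tailSum r (fun j => ‖a j‖) (n + 1) k := by
      rw [pairSum, Nat.add_sub_cancel, tailSum_succ]
      generalize pairSum (fun j => ‖a j‖)
        (fun m j => r * truncNorm r (m - 1) (φ (j + 1))) n (k + 1) = S at h0 hs hs0 ⊢
      generalize truncNorm r (n + 1) (φ k) = x at step hx ⊢
      generalize truncNorm r n (φ (k + 1)) = y at step h0 hx1 ⊢
      generalize tailSum r (fun j => ‖a j‖) n (k + 1) = P at h0 ⊢
      have hak := hA k
      generalize ‖a k‖ = α at step hak ⊢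
      have e1 : (x - α * (r * y) * x) * (1 - S) ≤ (α + r * y) * (1 - S) :=
        mul_le_mul_of_nonneg_right (by linarith) (by linarith)
      have e2 : 0 ≤ α * (r * y) * x * S := by positivity
      have e3 := mul_le_mul_of_nonneg_left h0 hr0
      have e4 : 0 ≤ α * S := by positivity
      linarith
    refine ⟨first, ?_⟩
    -- The factor on the left of `first` is at least `9/10`, and `10/9 ≤ 6/5`.
    nlinarith

theorem IsSchurChain.truncNorm_le (hr0 : 0 ≤ r) (hr1 : r < 1) (h : IsSchurChain φ a)
    (ha : IsSmallSeq r a) (n k : ℕ) :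
    truncNorm r n (φ k) ≤ 6 / 5 * tailSum r (fun j => ‖a j‖) n k :=
  (h.bootstrap hr0 hr1 ha n n le_rfl k).2

theorem IsSchurChain.mul_truncNorm_le (hr0 : 0 ≤ r) (hr1 : r < 1) (h : IsSchurChain φ a)
    (ha : IsSmallSeq r a) (n k : ℕ) :
    r * truncNorm r n (φ (k + 1)) ≤ 6 / 5 * tailSum r (fun j => ‖a j‖) (n + 1) k := by
  rw [tailSum_succ]
  have := mul_le_mul_of_nonneg_left (h.truncNorm_le hr0 hr1 ha n (k + 1)) hr0
  linarith [norm_nonneg (a k)]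

/-! ### Comparison of two Schur chains -/

theorem IsSchurChain.truncNorm_sub_succ_le (hr0 : 0 ≤ r) (hφ : IsSchurChain φ a)
    (hψ : IsSchurChain ψ b) (n k : ℕ) :
    truncNorm r (n + 1) (φ k - ψ k) ≤ ‖a k - b k‖ +
      r * truncNorm r n (φ (k + 1) - ψ (k + 1)) * (1 + ‖a k‖ * truncNorm r (n + 1) (φ k)) +
      r * truncNorm r n (ψ (k + 1)) * (‖a k - b k‖ * truncNorm r (n + 1) (φ k) +
        ‖b k‖ * truncNorm r (n + 1) (φ k - ψ k)) := by
  set p := PowerSeries.X * (φ (k + 1) - ψ (k + 1)) with hp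
  set q := PowerSeries.C ((starRingEnd ℂ) (a k)) * (p * φ k) with hq
  set s := PowerSeries.C ((starRingEnd ℂ) (a k - b k)) * φ k +
        PowerSeries.C ((starRingEnd ℂ) (b k)) * (φ k - ψ k) with hs
  have e : φ k - ψ k = (PowerSeries.C (a k - b k) + p) - (q + PowerSeries.X * ψ (k + 1) * s) := by
    simp only [hq, hs, hp, map_sub]
    linear_combination hφ k - hψ k
  have hp' : truncNorm r (n + 1) p = r * truncNorm r n (φ (k + 1) - ψ (k + 1)) :=
    truncNorm_X_mul _ _ _
  have hq' : truncNorm r (n + 1) q ≤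
      ‖a k‖ * (truncNorm r (n + 1) p * truncNorm r (n + 1) (φ k)) := by
    rw [hq, truncNorm_C_mul, RCLike.norm_conj]
    exact mul_le_mul_of_nonneg_left (truncNorm_mul_le hr0 _ _ _) (norm_nonneg _)
  have hs' : truncNorm r (n + 1) s ≤ ‖a k - b k‖ * truncNorm r (n + 1) (φ k) +
      ‖b k‖ * truncNorm r (n + 1) (φ k - ψ k) := by
    refine (truncNorm_add_le hr0 _ _ _).trans_eq ?_
    rw [truncNorm_C_mul, truncNorm_C_mul, RCLike.norm_conj, RCLike.norm_conj]
  have hv := truncNorm_mul_le hr0 (n + 1) (PowerSeries.X * ψ (k + 1)) s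
  rw [truncNorm_X_mul] at hv
  have hv' := mul_le_mul_of_nonneg_left hs'
    (mul_nonneg hr0 (truncNorm_nonneg hr0 n (ψ (k + 1))))
  have h1 := truncNorm_sub_le hr0 (n + 1) (PowerSeries.C (a k - b k) + p)
    (q + PowerSeries.X * ψ (k + 1) * s)
  rw [← e, hp, truncNorm_C_add_X_mul] at h1
  have h2 := truncNorm_add_le hr0 (n + 1) q (PowerSeries.X * ψ (k + 1) * s)
  rw [hp'] at hq'
  linarith

/-- The difference identity is solved for `X (φ_{k+1} - ψ_{k+1})`. The term `|a_k - b_k|` can stand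
on the left because the constant term of `φ_k - ψ_k` and its multiple of `X` share no coefficient,
so their norms add exactly. -/
theorem IsSchurChain.mul_truncNorm_sub_le (hr0 : 0 ≤ r) (hφ : IsSchurChain φ a)
    (hψ : IsSchurChain ψ b) (n k : ℕ) :
    r * truncNorm r n (φ (k + 1) - ψ (k + 1)) + ‖a k - b k‖ ≤ truncNorm r (n + 1) (φ k - ψ k) +
      r * truncNorm r n (φ (k + 1) - ψ (k + 1)) * (‖a k‖ * truncNorm r (n + 1) (φ k)) +
      r * truncNorm r n (ψ (k + 1)) * (‖a k - b k‖ * truncNorm r (n + 1) (φ k) +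
        ‖b k‖ * truncNorm r (n + 1) (φ k - ψ k)) := by
  set p := PowerSeries.X * (φ (k + 1) - ψ (k + 1)) with hp
  set q := PowerSeries.C ((starRingEnd ℂ) (a k)) * (p * φ k) with hq
  set s := PowerSeries.C ((starRingEnd ℂ) (a k - b k)) * φ k +
        PowerSeries.C ((starRingEnd ℂ) (b k)) * (φ k - ψ k) with hs
  set R := φ (k + 1) * (1 - PowerSeries.C ((starRingEnd ℂ) (a k)) * φ k) -
    ψ (k + 1) * (1 - PowerSeries.C ((starRingEnd ℂ) (b k)) * ψ k) with hR
  have e0 : φ k - ψ k = PowerSeries.C (a k - b k) + PowerSeries.X * R := by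
    simp only [hR, map_sub]
    linear_combination hφ k - hψ k
  have e : p = PowerSeries.X * R + (q + PowerSeries.X * ψ (k + 1) * s) := by
    simp only [hq, hs, hp, hR, map_sub]
    ring
  have hp' : truncNorm r (n + 1) p = r * truncNorm r n (φ (k + 1) - ψ (k + 1)) :=
    truncNorm_X_mul _ _ _
  have hD : truncNorm r (n + 1) (φ k - ψ k) = ‖a k - b k‖ + r * truncNorm r n R := by
    rw [e0, truncNorm_C_add_X_mul]
  have hq' : truncNorm r (n + 1) q ≤
      ‖a k‖ * (truncNorm r (n + 1) p * truncNorm r (n + 1) (φ k)) := by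
    rw [hq, truncNorm_C_mul, RCLike.norm_conj]
    exact mul_le_mul_of_nonneg_left (truncNorm_mul_le hr0 _ _ _) (norm_nonneg _)
  have hs' : truncNorm r (n + 1) s ≤ ‖a k - b k‖ * truncNorm r (n + 1) (φ k) +
      ‖b k‖ * truncNorm r (n + 1) (φ k - ψ k) := by
    refine (truncNorm_add_le hr0 _ _ _).trans_eq ?_
    rw [truncNorm_C_mul, truncNorm_C_mul, RCLike.norm_conj, RCLike.norm_conj]
  have hv := truncNorm_mul_le hr0 (n + 1) (PowerSeries.X * ψ (k + 1)) s
  rw [truncNorm_X_mul] at hv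
  have hv' := mul_le_mul_of_nonneg_left hs'
    (mul_nonneg hr0 (truncNorm_nonneg hr0 n (ψ (k + 1))))
  have h1 := truncNorm_add_le hr0 (n + 1) (PowerSeries.X * R)
    (q + PowerSeries.X * ψ (k + 1) * s)
  rw [← e, hp', truncNorm_X_mul] at h1
  have h2 := truncNorm_add_le hr0 (n + 1) q (PowerSeries.X * ψ (k + 1) * s)
  rw [hp'] at hq'
  linarith

/-- The accumulated loss `∑ (|a_k| ‖φ_k‖ + |b_k| ‖X ψ_{k+1}‖)` along two chains. -/
noncomputable def chainLoss (r : ℝ) (φ ψ : ℕ → PowerSeries ℂ) (a b : ℕ → ℂ) (n k : ℕ) : ℝ :=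
  pairSum (fun j => ‖a j‖) (fun m j => truncNorm r m (φ j)) n k +
    pairSum (fun j => ‖b j‖) (fun m j => r * truncNorm r (m - 1) (ψ (j + 1))) n k

theorem chainLoss_succ (r : ℝ) (φ ψ : ℕ → PowerSeries ℂ) (a b : ℕ → ℂ) (n k : ℕ) :
    chainLoss r φ ψ a b (n + 1) k = ‖a k‖ * truncNorm r (n + 1) (φ k) +
      ‖b k‖ * (r * truncNorm r n (ψ (k + 1))) + chainLoss r φ ψ a b n (k + 1) := by
  rw [chainLoss, pairSum, pairSum, Nat.add_sub_cancel, chainLoss]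
  ring

theorem chainLoss_nonneg (hr0 : 0 ≤ r) (n k : ℕ) : 0 ≤ chainLoss r φ ψ a b n k :=
  add_nonneg (pairSum_nonneg (fun _ => norm_nonneg _) (fun _ _ => truncNorm_nonneg hr0 _ _) _ _)
    (pairSum_nonneg (fun _ => norm_nonneg _)
      (fun _ _ => mul_nonneg hr0 (truncNorm_nonneg hr0 _ _)) _ _)

theorem chainLoss_le (hr0 : 0 ≤ r) (hr1 : r < 1) (hφ : IsSchurChain φ a)
    (hψ : IsSchurChain ψ b) (ha : IsSmallSeq r a) (hb : IsSmallSeq r b) (n k : ℕ) :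
    chainLoss r φ ψ a b n k ≤ 1 / 5 := by
  have h1 : pairSum (fun j => ‖a j‖) (fun m j => truncNorm r m (φ j)) n k ≤
      pairSum (fun j => ‖a j‖) (fun m j => 6 / 5 * tailSum r (fun j => ‖a j‖) m j) n k :=
    pairSum_mono (fun _ => norm_nonneg _) (fun m _ j => hφ.truncNorm_le hr0 hr1 ha m j) k
  have h2 : pairSum (fun j => ‖b j‖) (fun m j => r * truncNorm r (m - 1) (ψ (j + 1))) n k ≤
      pairSum (fun j => ‖b j‖) (fun m j => 6 / 5 * tailSum r (fun j => ‖b j‖) m j) n k := by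
    refine pairSum_mono (fun _ => norm_nonneg _) (fun m _ j => ?_) k
    rcases m with _ | m
    · simp [truncNorm_zero_left, tailSum_zero]
    · exact hψ.mul_truncNorm_le hr0 hr1 hb m j
  rw [pairSum_const_mul _ (6 / 5)] at h1 h2
  have h3 := ha.pairSum_le hr0 hr1 n k
  have h4 := hb.pairSum_le hr0 hr1 n k
  rw [chainLoss]
  linarith

/-- Each factor is at most `6/5` of a tail sum whose square is at most `1/12`, and `36/25 · 1/12 =
3/25`. -/
theorem IsSchurChain.mul_truncNorm_mul_truncNorm_le (hr0 : 0 ≤ r) (hr1 : r < 1) (hφ : IsSchurChain φ a)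
    (hψ : IsSchurChain ψ b) (ha : IsSmallSeq r a) (hb : IsSmallSeq r b) (n k : ℕ) :
    r * truncNorm r n (ψ (k + 1)) * truncNorm r (n + 1) (φ k) ≤ 3 / 25 := by
  have h1 := hφ.truncNorm_le hr0 hr1 ha (n + 1) k
  have h2 := hψ.mul_truncNorm_le hr0 hr1 hb n k
  have h3 := ha.tailSum_sq_le hr0 hr1 (n + 1) k
  have h4 := hb.tailSum_sq_le hr0 hr1 (n + 1) k
  have h5 := truncNorm_nonneg hr0 (n + 1) (φ k)
  have h6 := tailSum_nonneg hr0 (fun j => norm_nonneg (b j)) (n + 1) k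
  have h7 := mul_le_mul h2 h1 h5 (by positivity)
  nlinarith [sq_nonneg (tailSum r (fun j => ‖a j‖) (n + 1) k -
    tailSum r (fun j => ‖b j‖) (n + 1) k)]

theorem IsSchurChain.norm_mul_truncNorm_le (hr0 : 0 ≤ r) (hr1 : r < 1)
    (hψ : IsSchurChain ψ b) (hb : IsSmallSeq r b) (n k : ℕ) :
    ‖b k‖ * (r * truncNorm r n (ψ (k + 1))) ≤ 1 / 10 := by
  have h2 := hψ.mul_truncNorm_le hr0 hr1 hb n k
  have h4 := hb.tailSum_sq_le hr0 hr1 (n + 1) k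
  have h5 := hb.sq_le hr0 k
  have h7 := mul_le_mul_of_nonneg_left h2 (norm_nonneg (b k))
  nlinarith [sq_nonneg (‖b k‖ - tailSum r (fun j => ‖b j‖) (n + 1) k)]

/-- The constant `28/25 = 1 + 3/25` collects the direct contribution of `|a_k - b_k|` and its
contribution through `conj (a_k - b_k) X ψ_{k+1} φ_k`. The remaining error terms multiply the
differences themselves and are charged to `chainLoss`. -/
theorem IsSchurChain.upper_aux (hr0 : 0 ≤ r) (hr1 : r < 1) (hφ : IsSchurChain φ a)
    (hψ : IsSchurChain ψ b) (ha : IsSmallSeq r a) (hb : IsSmallSeq r b) (n k : ℕ) :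
    truncNorm r n (φ k - ψ k) * (1 - chainLoss r φ ψ a b n k) ≤
      28 / 25 * tailSum r (fun j => ‖a j - b j‖) n k := by
  induction n generalizing k with
  | zero => simp [truncNorm_zero_left, tailSum_zero]
  | succ n ih =>
    have h0 := ih (k + 1)
    have step := hφ.truncNorm_sub_succ_le hr0 hψ n k
    have hvx := hφ.mul_truncNorm_mul_truncNorm_le hr0 hr1 hψ ha hb n k
    have hT0 := chainLoss_nonneg (φ := φ) (ψ := ψ) (a := a) (b := b) hr0 n (k + 1)
    have hT := chainLoss_le hr0 hr1 hφ hψ ha hb n (k + 1)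
    have hT' := chainLoss_le hr0 hr1 hφ hψ ha hb (n + 1) k
    rw [chainLoss_succ] at hT' ⊢
    rw [tailSum_succ]
    have hx := truncNorm_nonneg hr0 (n + 1) (φ k)
    have hy := mul_nonneg hr0 (truncNorm_nonneg hr0 n (ψ (k + 1)))
    have hD := truncNorm_nonneg hr0 n (φ (k + 1) - ψ (k + 1))
    have hD' := truncNorm_nonneg hr0 (n + 1) (φ k - ψ k)
    have hα := mul_nonneg (norm_nonneg (a k)) hx
    have hβ := mul_nonneg (norm_nonneg (b k)) hy
    have he := norm_nonneg (a k - b k)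
    have hev := mul_le_mul_of_nonneg_left hvx he
    have step' : truncNorm r (n + 1) (φ k - ψ k) *
        (1 - ‖b k‖ * (r * truncNorm r n (ψ (k + 1)))) ≤ 28 / 25 * ‖a k - b k‖ +
          r * truncNorm r n (φ (k + 1) - ψ (k + 1)) *
            (1 + ‖a k‖ * truncNorm r (n + 1) (φ k)) := by linarith
    have h0' := mul_le_mul_of_nonneg_left h0 hr0
    clear hev hvx step hx hy h0
    generalize ‖a k‖ * truncNorm r (n + 1) (φ k) = α at *
    generalize ‖b k‖ * (r * truncNorm r n (ψ (k + 1))) = β at *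
    generalize chainLoss r φ ψ a b n (k + 1) = T at *
    generalize ‖a k - b k‖ = e at *
    generalize truncNorm r (n + 1) (φ k - ψ k) = D' at *
    generalize truncNorm r n (φ (k + 1) - ψ (k + 1)) = D at *
    generalize tailSum r (fun j => ‖a j - b j‖) n (k + 1) = E at *
    -- Multiplying by `1 - α` cancels the growth factor `1 + α`, since `(1 + α)(1 - α) ≤ 1`; the
    -- factor `1 - T` matches the induction hypothesis.
    have k1 := mul_le_mul_of_nonneg_right step'
      (mul_nonneg (show 0 ≤ 1 - α by linarith) (show 0 ≤ 1 - T by linarith))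
    have k2 : 1 - (α + β + T) ≤ (1 - β) * ((1 - α) * (1 - T)) := by
      nlinarith [mul_nonneg hα hβ, mul_nonneg hα hT0, mul_nonneg hβ hT0,
        mul_nonneg (mul_nonneg hα hβ) (show 0 ≤ 1 - T by linarith)]
    have k3 := mul_le_mul_of_nonneg_left k2 hD'
    have k4 : e * ((1 - α) * (1 - T)) ≤ e * 1 := by
      refine mul_le_mul_of_nonneg_left ?_ he
      nlinarith
    have k5 : r * D * (1 - T) * ((1 + α) * (1 - α)) ≤ r * D * (1 - T) * 1 := by
      refine mul_le_mul_of_nonneg_left (by nlinarith) ?_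
      exact mul_nonneg (mul_nonneg hr0 hD) (by linarith)
    linarith

/-- The constant `39/50 = 1 - 3/25 - 1/10` leaves room for the factor `1 + β` with `β ≤ 1/10`:
`39/50 · 11/10 ≤ 1 - 3/25`. -/
theorem IsSchurChain.lower_aux (hr0 : 0 ≤ r) (hr1 : r < 1) (hφ : IsSchurChain φ a)
    (hψ : IsSchurChain ψ b) (ha : IsSmallSeq r a) (hb : IsSmallSeq r b) (n k : ℕ) :
    39 / 50 * tailSum r (fun j => ‖a j - b j‖) n k * (1 - chainLoss r φ ψ a b n k) ≤
      truncNorm r n (φ k - ψ k) := by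
  induction n generalizing k with
  | zero => simp [truncNorm_zero_left, tailSum_zero]
  | succ n ih =>
    have h0 := ih (k + 1)
    have step := hφ.mul_truncNorm_sub_le hr0 hψ n k
    have hvx := hφ.mul_truncNorm_mul_truncNorm_le hr0 hr1 hψ ha hb n k
    have hbv := hψ.norm_mul_truncNorm_le hr0 hr1 hb n k
    have hT0 := chainLoss_nonneg (φ := φ) (ψ := ψ) (a := a) (b := b) hr0 n (k + 1)
    have hT := chainLoss_le hr0 hr1 hφ hψ ha hb n (k + 1)
    have hT' := chainLoss_le hr0 hr1 hφ hψ ha hb (n + 1) k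
    rw [chainLoss_succ] at hT' ⊢
    rw [tailSum_succ]
    have hx := truncNorm_nonneg hr0 (n + 1) (φ k)
    have hy := mul_nonneg hr0 (truncNorm_nonneg hr0 n (ψ (k + 1)))
    have hE := tailSum_nonneg hr0 (fun j => norm_nonneg (a j - b j)) n (k + 1)
    have hα := mul_nonneg (norm_nonneg (a k)) hx
    have hβ := mul_nonneg (norm_nonneg (b k)) hy
    have he := norm_nonneg (a k - b k)
    have hev := mul_le_mul_of_nonneg_left hvx he
    -- The constant term alone gives this. It makes `D' - 39/50 e` nonnegative, so that `(1 + β)(1 -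
    -- β) ≤ 1` may be multiplied by it.
    have heD : ‖a k - b k‖ ≤ truncNorm r (n + 1) (φ k - ψ k) := by
      have : φ k - ψ k = PowerSeries.C (a k - b k) + PowerSeries.X *
          (φ (k + 1) * (1 - PowerSeries.C ((starRingEnd ℂ) (a k)) * φ k) -
            ψ (k + 1) * (1 - PowerSeries.C ((starRingEnd ℂ) (b k)) * ψ k)) := by
        simp only [map_sub]
        linear_combination hφ k - hψ k
      rw [this, truncNorm_C_add_X_mul]
      linarith [mul_nonneg hr0 (truncNorm_nonneg hr0 n
        (φ (k + 1) * (1 - PowerSeries.C ((starRingEnd ℂ) (a k)) * φ k) -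
            ψ (k + 1) * (1 - PowerSeries.C ((starRingEnd ℂ) (b k)) * ψ k)))]
    have hebv := mul_le_mul_of_nonneg_left hbv he
    have hβα : ‖b k‖ * (r * truncNorm r n (ψ (k + 1))) * ‖a k - b k‖ ≤ 1 / 10 * ‖a k - b k‖ :=
      mul_le_mul_of_nonneg_right hbv he
    have step' : r * truncNorm r n (φ (k + 1) - ψ (k + 1)) *
        (1 - ‖a k‖ * truncNorm r (n + 1) (φ k)) ≤
        (1 + ‖b k‖ * (r * truncNorm r n (ψ (k + 1)))) *
          (truncNorm r (n + 1) (φ k - ψ k) - 39 / 50 * ‖a k - b k‖) := by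
      linarith
    have h0' := mul_le_mul_of_nonneg_left h0 hr0
    clear hev hvx step hx hy h0 hebv hβα hbv
    generalize ‖a k‖ * truncNorm r (n + 1) (φ k) = α at *
    generalize ‖b k‖ * (r * truncNorm r n (ψ (k + 1))) = β at *
    generalize chainLoss r φ ψ a b n (k + 1) = T at *
    generalize ‖a k - b k‖ = e at *
    generalize truncNorm r (n + 1) (φ k - ψ k) = D' at *
    generalize truncNorm r n (φ (k + 1) - ψ (k + 1)) = D at *
    generalize tailSum r (fun j => ‖a j - b j‖) n (k + 1) = E at *
    have k2 : 1 - (α + β + T) ≤ (1 - T) * ((1 - α) * (1 - β)) := by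
      nlinarith [mul_nonneg hα hβ, mul_nonneg hα hT0, mul_nonneg hβ hT0,
        mul_nonneg (mul_nonneg hα hβ) (show 0 ≤ 1 - T by linarith)]
    have k1 := mul_le_mul_of_nonneg_left k2 (mul_nonneg hr0 hE)
    have k3 := mul_le_mul_of_nonneg_right h0'
      (mul_nonneg (show 0 ≤ 1 - α by linarith) (show 0 ≤ 1 - β by linarith))
    have k4 := mul_le_mul_of_nonneg_right step' (show 0 ≤ 1 - β by linarith)
    have k5 : (D' - 39 / 50 * e) * ((1 + β) * (1 - β)) ≤ (D' - 39 / 50 * e) * 1 :=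
      mul_le_mul_of_nonneg_left (by nlinarith) (by linarith)
    have k6 : e * (1 - (α + β + T)) ≤ e * 1 := mul_le_mul_of_nonneg_left (by linarith) he
    linarith

theorem IsSchurChain.truncNorm_sub_le (hr0 : 0 ≤ r) (hr1 : r < 1) (hφ : IsSchurChain φ a)
    (hψ : IsSchurChain ψ b) (ha : IsSmallSeq r a) (hb : IsSmallSeq r b) (n : ℕ) :
    truncNorm r n (φ 0 - ψ 0) ≤ 2 * ∑ k ∈ Finset.range n, r ^ k * ‖a k - b k‖ := by
  have h1 := hφ.upper_aux hr0 hr1 hψ ha hb n 0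
  have h2 := chainLoss_le hr0 hr1 hφ hψ ha hb n 0
  have h3 := truncNorm_nonneg hr0 n (φ 0 - ψ 0)
  simp only [tailSum, zero_add] at h1
  nlinarith

theorem IsSchurChain.le_truncNorm_sub (hr0 : 0 ≤ r) (hr1 : r < 1) (hφ : IsSchurChain φ a)
    (hψ : IsSchurChain ψ b) (ha : IsSmallSeq r a) (hb : IsSmallSeq r b) (n : ℕ) :
    1 / 2 * ∑ k ∈ Finset.range n, r ^ k * ‖a k - b k‖ ≤ truncNorm r n (φ 0 - ψ 0) := by
  have h1 := hφ.lower_aux hr0 hr1 hψ ha hb n 0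
  have h2 := chainLoss_le hr0 hr1 hφ hψ ha hb n 0
  have h3 := tailSum_nonneg hr0 (fun j => norm_nonneg (a j - b j)) n 0
  simp only [tailSum, zero_add] at h1 h3
  nlinarith

end Chain

/-! ### Schur's algorithm in the disk and the Szegő product -/

theorem norm_sub_le_norm_one_sub_conj_mul {a w : ℂ} (ha : ‖a‖ ≤ 1) (hw : ‖w‖ ≤ 1) :
    ‖w - a‖ ≤ ‖1 - (starRingEnd ℂ) a * w‖ := by
  refine le_of_sq_le_sq ?_ (norm_nonneg _)
  have e : ‖1 - (starRingEnd ℂ) a * w‖ ^ 2 - ‖w - a‖ ^ 2 = (1 - ‖a‖ ^ 2) * (1 - ‖w‖ ^ 2) := by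
    simp only [← Complex.normSq_eq_norm_sq, Complex.normSq_apply, Complex.sub_re, Complex.sub_im,
      Complex.mul_re, Complex.mul_im, Complex.conj_re, Complex.conj_im, Complex.one_re,
      Complex.one_im]
    ring
  have h1 : ‖a‖ ^ 2 ≤ 1 := pow_le_one₀ (norm_nonneg _) ha
  have h2 : ‖w‖ ^ 2 ≤ 1 := pow_le_one₀ (norm_nonneg _) hw
  nlinarith [mul_nonneg (sub_nonneg.2 h1) (sub_nonneg.2 h2)]

theorem one_sub_conj_mul_ne_zero {a w : ℂ} (ha : ‖a‖ < 1) (hw : ‖w‖ ≤ 1) :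
    1 - (starRingEnd ℂ) a * w ≠ 0 := by
  intro h
  have h1 : (starRingEnd ℂ) a * w = 1 := (sub_eq_zero.1 h).symm
  have h2 : ‖a‖ * ‖w‖ = 1 := by rw [← RCLike.norm_conj a, ← norm_mul, h1, norm_one]
  nlinarith [norm_nonneg a, norm_nonneg w]

/-- Schwarz's lemma: `z F₁(z)` is a Möbius image of `F`, so it maps the disk into the closed disk
and vanishes at the origin; its divided difference there is `F₁`. -/
theorem IsSchur.schurStep {F : ℂ → ℂ} (hF : IsSchur F) (h0 : ‖F 0‖ < 1) :
    IsSchur (schurStep F) := by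
  have hden : ∀ z ∈ Metric.ball (0 : ℂ) 1, 1 - (starRingEnd ℂ) (F 0) * F z ≠ 0 := fun z hz =>
    one_sub_conj_mul_ne_zero h0 (hF.2 z hz)
  have hball : Metric.ball (0 : ℂ) 1 ∈ 𝓝 (0 : ℂ) := Metric.ball_mem_nhds _ one_pos
  have hd : DifferentiableOn ℂ (_root_.schurStep F) (Metric.ball 0 1) :=
    ((Complex.differentiableOn_dslope hball).2 hF.1).div
      ((differentiableOn_const 1).sub (hF.1.const_mul _)) hden
  refine ⟨hd, fun z hz => ?_⟩
  set M : ℂ → ℂ := fun z => z * _root_.schurStep F z with hM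
  have hMd : DifferentiableOn ℂ M (Metric.ball 0 1) := differentiableOn_id.mul hd
  have hmaps : Set.MapsTo M (Metric.ball 0 1) (Metric.closedBall (M 0) 1) := by
    intro z hz
    have : ‖M z‖ ≤ 1 := by
      rw [hM]
      simp only
      rw [mul_schurStep, norm_div]
      exact div_le_one_of_le₀ (norm_sub_le_norm_one_sub_conj_mul h0.le (hF.2 z hz)) (norm_nonneg _)
    simpa [hM] using this
  have key := Complex.norm_dslope_le_div_of_mapsTo_ball hMd hmaps hz
  rw [div_one] at key
  refine le_of_eq_of_le ?_ key
  congr 1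
  rcases eq_or_ne z 0 with rfl | hz0
  · have h1 : HasDerivAt M (1 * _root_.schurStep F 0 + 0 * deriv (_root_.schurStep F) 0) 0 :=
      (hasDerivAt_id (0 : ℂ)).mul (hd.differentiableAt hball).hasDerivAt
    rw [dslope_same, h1.deriv]
    ring
  · rw [dslope_of_ne _ hz0, slope_def_field]
    simp [hM, hz0]

theorem szegoEta_eq_zero_of_norm_eq_one {F : ℂ → ℂ} {k : ℕ} (h : ‖recCoeff F k‖ = 1) :
    szegoEta F = 0 := by
  refine tprod_of_exists_eq_zero ⟨k, ?_⟩
  rw [h]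
  norm_num

/-- A coefficient of modulus one would put a zero factor into the product, so `0 < szegoEta F` lets
every step be carried out. -/
theorem isSchur_schurIter {F : ℂ → ℂ} (hF : IsSchur F) (hη : 0 < szegoEta F) (k : ℕ) :
    IsSchur (schurIter F k) ∧ ‖recCoeff F k‖ < 1 := by
  have aux : ∀ k, IsSchur (schurIter F k) → ‖recCoeff F k‖ < 1 := fun k hk =>
    lt_of_le_of_ne (hk.2 0 (Metric.mem_ball_self one_pos)) fun h =>
      hη.ne' (szegoEta_eq_zero_of_norm_eq_one h)
  induction k with
  | zero => exact ⟨hF, aux 0 hF⟩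
  | succ k ih => exact ⟨ih.1.schurStep ih.2, aux (k + 1) (ih.1.schurStep ih.2)⟩

/-- All factors lie in `[0, 1]`, so the finite products decrease; this yields convergence and
identifies the infinite product with their infimum. -/
theorem szegoEta_le_prod {F : ℂ → ℂ} (h : ∀ k, ‖recCoeff F k‖ < 1) (s : Finset ℕ) :
    szegoEta F ≤ ∏ k ∈ s, (1 - ‖recCoeff F k‖ ^ 2) := by
  have h0 : ∀ k, 0 ≤ 1 - ‖recCoeff F k‖ ^ 2 := fun k =>
    sub_nonneg.2 (pow_le_one₀ (norm_nonneg _) (h k).le)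
  have h1 : ∀ k, 1 - ‖recCoeff F k‖ ^ 2 ≤ 1 := fun k => by linarith [sq_nonneg ‖recCoeff F k‖]
  have hanti : Antitone fun s : Finset ℕ => ∏ k ∈ s, (1 - ‖recCoeff F k‖ ^ 2) := by
    intro s t hst
    simp only
    rw [← Finset.prod_sdiff hst]
    exact mul_le_of_le_one_left (Finset.prod_nonneg fun k _ => h0 k)
      (Finset.prod_le_one (fun k _ => h0 k) fun k _ => h1 k)
  have hbdd : BddBelow (Set.range fun s : Finset ℕ => ∏ k ∈ s, (1 - ‖recCoeff F k‖ ^ 2)) :=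
    ⟨0, by rintro _ ⟨s, rfl⟩; exact Finset.prod_nonneg fun k _ => h0 k⟩
  have hp : HasProd (fun k => 1 - ‖recCoeff F k‖ ^ 2) _ := tendsto_atTop_ciInf hanti hbdd
  rw [szegoEta, hp.tprod_eq]
  exact ciInf_le hbdd s

theorem sum_norm_sq_le_neg_log_szegoEta {F : ℂ → ℂ} (hη : 0 < szegoEta F)
    (h : ∀ k, ‖recCoeff F k‖ < 1) (n : ℕ) :
    ∑ k ∈ Finset.range n, ‖recCoeff F k‖ ^ 2 ≤ -Real.log (szegoEta F) := by
  have hpos : ∀ k, 0 < 1 - ‖recCoeff F k‖ ^ 2 := fun k =>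
    sub_pos.2 (pow_lt_one₀ (norm_nonneg _) (h k) two_ne_zero)
  have h1 := Real.log_le_log hη (szegoEta_le_prod h (Finset.range n))
  rw [Real.log_prod fun k _ => (hpos k).ne'] at h1
  have h2 : ∑ k ∈ Finset.range n, Real.log (1 - ‖recCoeff F k‖ ^ 2) ≤
      ∑ k ∈ Finset.range n, -‖recCoeff F k‖ ^ 2 :=
    Finset.sum_le_sum fun k _ => by linarith [Real.log_le_sub_one_of_pos (hpos k)]
  rw [Finset.sum_neg_distrib] at h2
  linarith

theorem isSmallSeq_recCoeff {F : ℂ → ℂ} (hη : 0 < szegoEta F) (h : ∀ k, ‖recCoeff F k‖ < 1)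
    {r m : ℝ} (hm0 : 0 < m) (hm : m ≤ szegoEta F) (hr : 12 * Real.log m⁻¹ ≤ 1 - r) :
    IsSmallSeq r (recCoeff F) := by
  intro n
  have h1 := sum_norm_sq_le_neg_log_szegoEta hη h n
  have h2 := Real.log_le_log hm0 hm
  rw [Real.log_inv] at hr
  linarith

/-! ### From analytic functions to formal power series -/

/-- The Taylor series at the origin as a formal power series. -/
noncomputable def taylorPS (F : ℂ → ℂ) : PowerSeries ℂ :=
  PowerSeries.mk fun n => (n.factorial : ℂ)⁻¹ * iteratedDeriv n F 0

theorem taylorPS_congr {f g : ℂ → ℂ} (h : f =ᶠ[𝓝 0] g) : taylorPS f = taylorPS g := by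
  ext n
  simp only [taylorPS, PowerSeries.coeff_mk]
  rw [h.iteratedDeriv_eq n]

theorem taylorPS_mul {f g : ℂ → ℂ} (hf : AnalyticAt ℂ f 0) (hg : AnalyticAt ℂ g 0) :
    taylorPS (fun z => f z * g z) = taylorPS f * taylorPS g := by
  ext n
  simp only [taylorPS, PowerSeries.coeff_mk, iteratedDeriv_fun_mul hf.contDiffAt hg.contDiffAt,
    Finset.mul_sum, PowerSeries.coeff_mul, Finset.Nat.sum_antidiagonal_eq_sum_range_succ_mk,
    Nat.succ_eq_add_one]
  refine Finset.sum_congr rfl fun i hi ↦ ?_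
  rw [Nat.cast_choose _ (by grind)]
  field_simp [Nat.factorial_ne_zero]

theorem taylorPS_add {f g : ℂ → ℂ} (hf : AnalyticAt ℂ f 0) (hg : AnalyticAt ℂ g 0) :
    taylorPS (fun z => f z + g z) = taylorPS f + taylorPS g := by
  ext n
  simp only [taylorPS, PowerSeries.coeff_mk, map_add,
    iteratedDeriv_fun_add hf.contDiffAt hg.contDiffAt, mul_add]

theorem taylorPS_sub {f g : ℂ → ℂ} (hf : AnalyticAt ℂ f 0) (hg : AnalyticAt ℂ g 0) :
    taylorPS (fun z => f z - g z) = taylorPS f - taylorPS g := by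
  ext n
  simp only [taylorPS, PowerSeries.coeff_mk, map_sub,
    iteratedDeriv_fun_sub hf.contDiffAt hg.contDiffAt, mul_sub]

theorem taylorPS_const (c : ℂ) : taylorPS (fun _ => c) = PowerSeries.C c := by
  ext n
  simp only [taylorPS, PowerSeries.coeff_mk, iteratedDeriv_const, PowerSeries.coeff_C]
  split_ifs with h <;> simp [h]

theorem taylorPS_id : taylorPS (fun z => z) = PowerSeries.X := by
  ext n
  rw [taylorPS, PowerSeries.coeff_mk, PowerSeries.coeff_X]
  rcases n with _ | _ | n
  · simp
  · simp [iteratedDeriv_one]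
  · have : deriv (fun z : ℂ => z) = fun _ => 1 := by ext; simp
    rw [iteratedDeriv_succ', this, iteratedDeriv_const]
    simp

theorem IsSchur.analyticAt {F : ℂ → ℂ} (hF : IsSchur F) : AnalyticAt ℂ F 0 :=
  hF.1.analyticAt (Metric.ball_mem_nhds _ one_pos)

theorem taylorPS_schurStep {F : ℂ → ℂ} (hF : IsSchur F) (h0 : ‖F 0‖ < 1) :
    taylorPS F = PowerSeries.C (F 0) + PowerSeries.X * taylorPS (schurStep F) *
      (1 - PowerSeries.C ((starRingEnd ℂ) (F 0)) * taylorPS F) := by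
  have hF' := (hF.schurStep h0).analyticAt
  have ha := hF.analyticAt
  have hc : AnalyticAt ℂ (fun z => (starRingEnd ℂ) (F 0) * F z) 0 := analyticAt_const.mul ha
  have h1 : AnalyticAt ℂ (fun z => 1 - (starRingEnd ℂ) (F 0) * F z) 0 := analyticAt_const.sub hc
  have hx : AnalyticAt ℂ (fun z : ℂ => z) 0 := analyticAt_id
  have hxs : AnalyticAt ℂ (fun z : ℂ => z * schurStep F z) 0 := hx.mul hF'
  have hm : AnalyticAt ℂ
      (fun z : ℂ => z * schurStep F z * (1 - (starRingEnd ℂ) (F 0) * F z)) 0 := hxs.mul h1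
  have e : F =ᶠ[𝓝 0] fun z => F 0 + z * schurStep F z * (1 - (starRingEnd ℂ) (F 0) * F z) := by
    filter_upwards [Metric.ball_mem_nhds (0 : ℂ) one_pos] with z hz
    rw [mul_schurStep, div_mul_cancel₀ _ (one_sub_conj_mul_ne_zero h0 (hF.2 z hz))]
    ring
  conv_lhs => rw [taylorPS_congr e]
  rw [taylorPS_add analyticAt_const hm, taylorPS_mul hxs h1, taylorPS_mul hx hF',
    taylorPS_sub analyticAt_const hc, taylorPS_mul analyticAt_const ha, taylorPS_const,
    taylorPS_const, taylorPS_const, taylorPS_id, map_one]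

theorem isSchurChain_taylorPS {F : ℂ → ℂ} (hF : IsSchur F) (hη : 0 < szegoEta F) :
    IsSchurChain (fun k => taylorPS (schurIter F k)) (recCoeff F) := fun k =>
  taylorPS_schurStep (isSchur_schurIter hF hη k).1 (isSchur_schurIter hF hη k).2

/-! ### Derivative of the Poisson integral and radial limits -/

/-- Cauchy's formula is applied to the divided difference `dslope f w`, whose value at `w` is the
derivative; the term `f w / (z - w)²` integrates to zero. -/
theorem DiffContOnCl.circleIntegral_sub_sq_inv_mul {f : ℂ → ℂ} {c w : ℂ} {R : ℝ}
    (hf : DiffContOnCl ℂ f (Metric.ball c R)) (hw : w ∈ Metric.ball c R) :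
    (∮ z in C(c, R), ((z - w) ^ 2)⁻¹ * f z) = 2 * Real.pi * Complex.I * deriv f w := by
  have hR := Metric.pos_of_mem_ball hw
  have hnhds : Metric.closedBall c R ∈ 𝓝 w :=
    mem_of_superset (Metric.isOpen_ball.mem_nhds hw) Metric.ball_subset_closedBall
  have hf' : DiffContOnCl ℂ (dslope f w) (Metric.ball c R) := by
    refine DiffContOnCl.mk_ball ((Complex.differentiableOn_dslope
      (Metric.isOpen_ball.mem_nhds hw)).2 hf.differentiableOn) ?_
    exact (continuousOn_dslope hnhds).2
      ⟨hf.continuousOn_ball, hf.differentiableAt Metric.isOpen_ball hw⟩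
  have h0 := hf'.circleIntegral_sub_inv_smul hw
  rw [dslope_same] at h0
  simp only [smul_eq_mul] at h0
  rw [← h0]
  have h1 : ContinuousOn (fun z : ℂ => ((z - w) ^ 2)⁻¹) (Metric.sphere c R) := by
    refine ((continuous_id'.sub continuous_const).pow 2).continuousOn.inv₀ fun z hz h => ?_
    exact Metric.sphere_disjoint_ball.ne_of_mem hz hw (sub_eq_zero.mp (sq_eq_zero_iff.mp h))
  trans ∮ z in C(c, R), (((z - w) ^ 2)⁻¹ * f z - ((z - w) ^ 2)⁻¹ * f w)
  · have h2 : CircleIntegrable (fun z : ℂ => ((z - w) ^ 2)⁻¹ * f z) c R :=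
      ContinuousOn.circleIntegrable hR.le
        (h1.mul (hf.continuousOn_ball.mono Metric.sphere_subset_closedBall))
    have h3 : CircleIntegrable (fun z : ℂ => ((z - w) ^ 2)⁻¹ * f w) c R :=
      ContinuousOn.circleIntegrable hR.le (h1.mul continuousOn_const)
    have h4 : (∮ z : ℂ in C(c, R), ((z - w) ^ 2)⁻¹) = 0 := by
      simpa using! circleIntegral.integral_sub_zpow_of_ne (by decide : (-2 : ℤ) ≠ -1) c w R
    have h5 : (∮ z : ℂ in C(c, R), ((z - w) ^ 2)⁻¹ * f w) = 0 := by
      have := circleIntegral.integral_smul_const (fun z : ℂ => ((z - w) ^ 2)⁻¹) (f w) c R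
      simp only [smul_eq_mul] at this
      rw [this, h4, zero_mul]
    rw [circleIntegral.integral_sub h2 h3, h5, sub_zero]
  · refine circleIntegral.integral_congr hR.le fun z hz => ?_
    have hne := Metric.sphere_disjoint_ball.ne_of_mem hz hw
    simp only [dslope_of_ne _ hne, slope_def_field]
    have : z - w ≠ 0 := sub_ne_zero.2 hne
    field_simp

/-- Minus the angular derivative of the Poisson kernel `(1 - ρ²) / (1 - 2 ρ cos θ + ρ²)`. -/
noncomputable def conjPoissonDeriv (ρ θ : ℝ) : ℝ :=
  2 * ρ * (1 - ρ ^ 2) * Real.sin θ / (1 - 2 * ρ * Real.cos θ + ρ ^ 2) ^ 2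

theorem poissonDenom_pos {ρ : ℝ} (h0 : 0 ≤ ρ) (h1 : ρ < 1) (θ : ℝ) :
    0 < 1 - 2 * ρ * Real.cos θ + ρ ^ 2 := by
  nlinarith [Real.cos_le_one θ, mul_nonneg h0 (sub_nonneg.2 (Real.cos_le_one θ)),
    mul_pos (sub_pos.2 h1) (sub_pos.2 h1)]

theorem continuous_conjPoissonDeriv {ρ : ℝ} (h0 : 0 ≤ ρ) (h1 : ρ < 1) :
    Continuous (conjPoissonDeriv ρ) := by
  unfold conjPoissonDeriv
  exact Continuous.div (by fun_prop) (by fun_prop)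
    fun θ => pow_ne_zero 2 (poissonDenom_pos h0 h1 θ).ne'

/-- The first term is the Cauchy kernel for the derivative at `ρ`. The second is analytic in the
disk and integrates to zero against analytic functions, but subtracting it makes the kernel real and
concentrated at `θ = 0`. -/
theorem conjPoissonDeriv_eq {ρ : ℝ} (h0 : 0 ≤ ρ) (h1 : ρ < 1) (θ : ℝ) :
    (conjPoissonDeriv ρ θ : ℂ) = circleMap 0 1 θ * Complex.I *
      (ρ * (((circleMap 0 1 θ - ρ) ^ 2)⁻¹ - ((1 - ρ * circleMap 0 1 θ) ^ 2)⁻¹)) := by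
  have hq := (poissonDenom_pos h0 h1 θ).ne'
  set w := circleMap 0 1 θ with hw
  have hwe : w = Real.cos θ + Real.sin θ * Complex.I := by
    rw [hw, circleMap, Complex.exp_mul_I]
    push_cast
    ring
  have hcs : (Real.cos θ : ℂ) ^ 2 + (Real.sin θ : ℂ) ^ 2 = 1 := by
    exact_mod_cast Real.cos_sq_add_sin_sq θ
  set q : ℂ := ((1 - 2 * ρ * Real.cos θ + ρ ^ 2 : ℝ) : ℂ) with hqd
  have hq0 : q ≠ 0 := Complex.ofReal_ne_zero.2 hq
  have hqe : q = 1 - 2 * ρ * Real.cos θ + ρ ^ 2 := by rw [hqd]; push_cast; ring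
  have hw0 : w ≠ 0 := by
    rw [hw]
    exact circleMap_ne_center one_ne_zero
  have hprod : (w - ρ) * (1 - ρ * w) = w * q := by
    rw [hqe, hwe]
    linear_combination (ρ : ℂ) * hcs - (ρ : ℂ) * (Real.sin θ : ℂ) ^ 2 * Complex.I_sq
  have hw2 : Complex.I * (1 - w ^ 2) = 2 * Real.sin θ * w := by
    rw [hwe]
    linear_combination (-Complex.I) * hcs - (Real.sin θ : ℂ) * (2 * Real.cos θ +
      Complex.I * Real.sin θ) * Complex.I_sq
  have hu : w - ρ ≠ 0 := left_ne_zero_of_mul (hprod ▸ mul_ne_zero hw0 hq0)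
  have hv : 1 - ρ * w ≠ 0 := right_ne_zero_of_mul (hprod ▸ mul_ne_zero hw0 hq0)
  have hdiff : ((w - ρ) ^ 2)⁻¹ - ((1 - ρ * w) ^ 2)⁻¹ =
      (1 - (ρ : ℂ) ^ 2) * (1 - w ^ 2) / (w * q) ^ 2 := by
    rw [inv_sub_inv (pow_ne_zero 2 hu) (pow_ne_zero 2 hv), ← hprod, mul_pow]
    congr 1
    ring
  have hL : (conjPoissonDeriv ρ θ : ℂ) = 2 * ρ * (1 - (ρ : ℂ) ^ 2) * Real.sin θ / q ^ 2 := by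
    rw [conjPoissonDeriv, hqd]
    push_cast
    ring
  rw [hL, hdiff]
  field_simp
  linear_combination (-(ρ : ℂ) * (1 - (ρ : ℂ) ^ 2)) * hw2

theorem integral_conjPoissonDeriv_mul {f : ℂ → ℂ} (hf : DiffContOnCl ℂ f (Metric.ball 0 1))
    {ρ : ℝ} (h0 : 0 ≤ ρ) (h1 : ρ < 1) :
    ∫ θ in -Real.pi..Real.pi, (conjPoissonDeriv ρ θ : ℂ) * f (circleMap 0 1 θ) =
      2 * Real.pi * Complex.I * ρ * deriv f ρ := by
  have hρ : (ρ : ℂ) ∈ Metric.ball (0 : ℂ) 1 := by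
    simpa [abs_of_nonneg h0] using h1
  have hper : Function.Periodic
      (fun θ : ℝ => (conjPoissonDeriv ρ θ : ℂ) * f (circleMap 0 1 θ)) (2 * Real.pi) := by
    intro θ
    simp only [conjPoissonDeriv, Real.sin_add_two_pi, Real.cos_add_two_pi,
      periodic_circleMap 0 1 θ]
  have hshift := hper.intervalIntegral_add_eq (-Real.pi) 0
  rw [show -Real.pi + 2 * Real.pi = Real.pi by ring, zero_add] at hshift
  rw [hshift]
  have hne : ∀ z ∈ closure (Metric.ball (0 : ℂ) 1), (1 - ρ * z) ^ 2 ≠ 0 := by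
    intro z hz
    rw [closure_ball _ one_ne_zero, mem_closedBall_zero_iff] at hz
    have := one_sub_conj_mul_ne_zero (a := (ρ : ℂ)) (by simpa [abs_of_nonneg h0] using h1) hz
    rw [Complex.conj_ofReal] at this
    exact pow_ne_zero 2 this
  have hg : DiffContOnCl ℂ (fun z : ℂ => ((1 - (ρ : ℂ) * z) ^ 2)⁻¹ * f z) (Metric.ball 0 1) := by
    have : DiffContOnCl ℂ (fun z : ℂ => (1 - (ρ : ℂ) * z) ^ 2) (Metric.ball 0 1) :=
      Differentiable.diffContOnCl (by fun_prop)
    exact (this.inv hne).smul hf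
  have e1 := hf.circleIntegral_sub_sq_inv_mul hρ
  have e2 := hg.circleIntegral_eq_zero zero_le_one
  have hsub := Metric.sphere_subset_closedBall (x := (0 : ℂ)) (ε := 1)
  have i1 : CircleIntegrable (fun z : ℂ => ((z - ρ) ^ 2)⁻¹ * f z) 0 1 := by
    refine ContinuousOn.circleIntegrable zero_le_one
      (ContinuousOn.mul ?_ (hf.continuousOn_ball.mono hsub))
    refine ((continuous_id'.sub continuous_const).pow 2).continuousOn.inv₀ fun z hz h => ?_
    exact Metric.sphere_disjoint_ball.ne_of_mem hz hρ (sub_eq_zero.mp (sq_eq_zero_iff.mp h))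
  have i2 : CircleIntegrable (fun z : ℂ => ((1 - ρ * z) ^ 2)⁻¹ * f z) 0 1 :=
    ContinuousOn.circleIntegrable zero_le_one (hg.continuousOn_ball.mono hsub)
  have e3 := circleIntegral.integral_sub i1 i2
  rw [e1, e2, sub_zero] at e3
  have e4 := circleIntegral.integral_const_mul (ρ : ℂ)
    (fun z => ((z - ρ) ^ 2)⁻¹ * f z - ((1 - ρ * z) ^ 2)⁻¹ * f z) 0 1
  rw [e3] at e4
  rw [show 2 * Real.pi * Complex.I * ρ * deriv f ρ =
    ρ * (2 * Real.pi * Complex.I * deriv f ρ) by ring, ← e4, circleIntegral]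
  refine intervalIntegral.integral_congr fun θ _ => ?_
  simp only [conjPoissonDeriv_eq h0 h1, deriv_circleMap, smul_eq_mul]
  ring

/-- The imaginary part of the reproducing formula for `f(z) = z`. It bounds the kernel's mass with
weight `|sin θ|` uniformly in `ρ`. -/
theorem integral_conjPoissonDeriv_mul_sin {ρ : ℝ} (h0 : 0 ≤ ρ) (h1 : ρ < 1) :
    ∫ θ in -Real.pi..Real.pi, conjPoissonDeriv ρ θ * Real.sin θ = 2 * Real.pi * ρ := by
  have h := integral_conjPoissonDeriv_mul (f := fun z => z)
    (differentiable_id.diffContOnCl) h0 h1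
  have hc := continuous_conjPoissonDeriv h0 h1
  have hint : IntervalIntegrable (fun θ => (conjPoissonDeriv ρ θ : ℂ) * circleMap 0 1 θ) volume
      (-Real.pi) Real.pi :=
    ((Complex.continuous_ofReal.comp hc).mul (continuous_circleMap 0 1)).intervalIntegrable _ _
  have h2 := Complex.imCLM.intervalIntegral_comp_comm hint
  rw [h] at h2
  have e : ∀ θ : ℝ, Complex.imCLM ((conjPoissonDeriv ρ θ : ℂ) * circleMap 0 1 θ) =
      conjPoissonDeriv ρ θ * Real.sin θ := by
    intro θ
    simp [circleMap, Complex.exp_ofReal_mul_I_im]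
  simp only [e] at h2
  rw [h2]
  simp

theorem conjPoissonDeriv_mul_sin_nonneg {ρ : ℝ} (h0 : 0 ≤ ρ) (h1 : ρ < 1) (θ : ℝ) :
    |conjPoissonDeriv ρ θ| * |Real.sin θ| = conjPoissonDeriv ρ θ * Real.sin θ := by
  rw [← abs_mul, abs_of_nonneg]
  have h2 : 0 ≤ 1 - ρ ^ 2 := by nlinarith
  have : conjPoissonDeriv ρ θ * Real.sin θ =
      2 * ρ * (1 - ρ ^ 2) * Real.sin θ ^ 2 / (1 - 2 * ρ * Real.cos θ + ρ ^ 2) ^ 2 := by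
    rw [conjPoissonDeriv]; ring
  rw [this]
  positivity

theorem abs_conjPoissonDeriv_le {ρ δ : ℝ} (h0 : 1 / 2 ≤ ρ) (h1 : ρ < 1) (hδ0 : 0 < δ) {θ : ℝ}
    (hδ : δ ≤ |θ|) (hθ : |θ| ≤ Real.pi) :
    |conjPoissonDeriv ρ θ| ≤ 2 * (1 - ρ ^ 2) / (1 - Real.cos δ) ^ 2 := by
  have hcos : Real.cos θ ≤ Real.cos δ := by
    rw [← Real.cos_abs θ]
    exact Real.cos_le_cos_of_nonneg_of_le_pi hδ0.le hθ hδ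
  have hcδ : Real.cos δ < 1 := by
    have := Real.cos_lt_cos_of_nonneg_of_le_pi le_rfl (hδ.trans hθ) hδ0
    rwa [Real.cos_zero] at this
  have hq : 1 - Real.cos δ ≤ 1 - 2 * ρ * Real.cos θ + ρ ^ 2 := by
    nlinarith [sq_nonneg (1 - ρ), mul_nonneg (show 0 ≤ 2 * ρ - 1 by linarith)
      (show 0 ≤ 1 - Real.cos θ by linarith)]
  have h2 : 0 ≤ 1 - ρ ^ 2 := by nlinarith
  rw [conjPoissonDeriv, abs_div, abs_of_nonneg (a := (1 - 2 * ρ * Real.cos θ + ρ ^ 2) ^ 2)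
    (sq_nonneg _)]
  refine div_le_div₀ (by linarith) ?_ (pow_pos (sub_pos.2 hcδ) 2)
    (pow_le_pow_left₀ (sub_pos.2 hcδ).le hq 2)
  rw [abs_mul, abs_of_nonneg (by positivity : 0 ≤ 2 * ρ * (1 - ρ ^ 2))]
  have := Real.abs_sin_le_one θ
  have h3 : 2 * ρ * (1 - ρ ^ 2) ≤ 2 * (1 - ρ ^ 2) := by nlinarith
  exact (mul_le_of_le_one_right (by positivity) this).trans h3

/-- For `|θ| < δ` the boundary values are at most a small multiple of `|sin θ|`, against which the
kernel has bounded mass; for larger `|θ|` the kernel is `O(1 - ρ²)`. -/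
theorem tendsto_deriv_zero_of_isLittleO {H : ℂ → ℂ} (hH : DiffContOnCl ℂ H (Metric.ball 0 1))
    (h : (fun θ : ℝ => H (circleMap 0 1 θ)) =o[𝓝 0] fun θ : ℝ => θ) :
    Tendsto (fun ρ : ℝ => deriv H ρ) (𝓝[<] 1) (𝓝 0) := by
  have hcont : Continuous fun θ : ℝ => H (circleMap 0 1 θ) := by
    refine hH.continuousOn_ball.comp_continuous (continuous_circleMap 0 1) fun θ => ?_
    exact circleMap_mem_closedBall 0 zero_le_one θ
  obtain ⟨M, hM⟩ : ∃ M, ∀ z ∈ Metric.closedBall (0 : ℂ) 1, ‖H z‖ ≤ M :=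
    (isCompact_closedBall (0 : ℂ) 1).exists_bound_of_continuousOn hH.continuousOn_ball
  have hM0 : 0 ≤ M := (norm_nonneg _).trans (hM 0 (by simp))
  rw [Metric.tendsto_nhds]
  intro ε hε
  have hlo := h.def (show 0 < ε / 8 by positivity)
  obtain ⟨δ', hδ'0, hδ'⟩ := Metric.eventually_nhds_iff.1 hlo
  set δ := min (δ' / 2) (Real.pi / 2) with hδ
  have hδ0 : 0 < δ := lt_min (by positivity) (by positivity)
  have hδπ : δ ≤ Real.pi / 2 := min_le_right _ _
  have hδδ : δ < δ' := (min_le_left _ _).trans_lt (by linarith)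
  have hcδ : 0 < 1 - Real.cos δ := by
    have := Real.cos_lt_cos_of_nonneg_of_le_pi le_rfl (by linarith [Real.pi_pos]) hδ0
    rw [Real.cos_zero] at this
    linarith
  set K := 4 * M / (1 - Real.cos δ) ^ 2 with hK
  have hK0 : 0 ≤ K := by positivity
  have hlim : Tendsto (fun ρ : ℝ => K * (1 - ρ ^ 2)) (𝓝[<] 1) (𝓝 0) := by
    have : ContinuousAt (fun ρ : ℝ => K * (1 - ρ ^ 2)) 1 := by fun_prop
    simpa [ContinuousAt] using this.tendsto.mono_left nhdsWithin_le_nhds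
  filter_upwards [self_mem_nhdsWithin,
    mem_nhdsWithin_of_mem_nhds (Ici_mem_nhds (show (1 / 2 : ℝ) < 1 by norm_num)),
    hlim.eventually_lt_const (show 0 < ε / 2 by positivity)] with ρ h1 h0 hsmall
  have h1' : ρ < 1 := h1
  have h0' : 1 / 2 ≤ ρ := h0
  have hρ0 : 0 ≤ ρ := by linarith
  have hKc := continuous_conjPoissonDeriv hρ0 h1'
  have hpt : ∀ θ : ℝ, |θ| ≤ Real.pi →
      ‖(conjPoissonDeriv ρ θ : ℂ) * H (circleMap 0 1 θ)‖ ≤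
        ε / 4 * (conjPoissonDeriv ρ θ * Real.sin θ) + K / 2 * (1 - ρ ^ 2) := by
    intro θ hθ
    have hsin := conjPoissonDeriv_mul_sin_nonneg hρ0 h1' θ
    rw [norm_mul, Complex.norm_real, Real.norm_eq_abs, ← hsin]
    have h2 : 0 ≤ 1 - ρ ^ 2 := by nlinarith
    rcases lt_or_ge |θ| δ with hlt | hge
    · have h3 : ‖H (circleMap 0 1 θ)‖ ≤ ε / 8 * ‖θ‖ :=
        hδ' (by simpa using hlt.trans hδδ)
      have h4 := Real.mul_abs_le_abs_sin (hlt.le.trans hδπ)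
      have h5 : |θ| ≤ 2 * |Real.sin θ| := by
        have hpi := Real.pi_le_four
        have : 1 / 2 ≤ 2 / Real.pi := by
          rw [div_le_div_iff₀ (by norm_num) Real.pi_pos]; linarith
        nlinarith [abs_nonneg θ]
      rw [Real.norm_eq_abs] at h3
      have h6 : ‖H (circleMap 0 1 θ)‖ ≤ ε / 4 * |Real.sin θ| := by nlinarith
      have h7 := mul_le_mul_of_nonneg_left h6 (abs_nonneg (conjPoissonDeriv ρ θ))
      have h8 : 0 ≤ K / 2 * (1 - ρ ^ 2) := by positivity
      linarith
    · have h3 := abs_conjPoissonDeriv_le h0' h1' hδ0 hge hθ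
      have h4 := hM _ (circleMap_mem_closedBall 0 zero_le_one θ)
      have h5 := mul_le_mul h3 h4 (norm_nonneg _) (by positivity)
      have h6 : 2 * (1 - ρ ^ 2) / (1 - Real.cos δ) ^ 2 * M = K / 2 * (1 - ρ ^ 2) := by
        rw [hK]; ring
      rw [h6] at h5
      have h7 : 0 ≤ ε / 4 * (|conjPoissonDeriv ρ θ| * |Real.sin θ|) := by positivity
      linarith
  have hle : -Real.pi ≤ Real.pi := by linarith [Real.pi_pos]
  have hi1 : IntervalIntegrable (fun θ => ε / 4 * (conjPoissonDeriv ρ θ * Real.sin θ)) volume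
      (-Real.pi) Real.pi :=
    (continuous_const.mul (hKc.mul Real.continuous_sin)).intervalIntegrable _ _
  have hi2 : IntervalIntegrable (fun _ : ℝ => K / 2 * (1 - ρ ^ 2)) volume
      (-Real.pi) Real.pi := continuous_const.intervalIntegrable _ _
  have hnorm := intervalIntegral.norm_integral_le_of_norm_le hle
    (Eventually.of_forall fun θ hθ => hpt θ (abs_le.2 ⟨hθ.1.le, hθ.2⟩)) (hi1.add hi2)
  rw [integral_conjPoissonDeriv_mul hH hρ0 h1', intervalIntegral.integral_add hi1 hi2,
    intervalIntegral.integral_const_mul, integral_conjPoissonDeriv_mul_sin hρ0 h1',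
    intervalIntegral.integral_const, smul_eq_mul] at hnorm
  simp only [norm_mul, Complex.norm_real, Complex.norm_I, Complex.norm_ofNat, Real.norm_eq_abs,
    abs_of_pos Real.pi_pos, abs_of_nonneg hρ0] at hnorm
  rw [dist_zero_right]
  have hπ := Real.pi_pos
  have h9 : 2 * Real.pi * (ρ * ‖deriv H ρ‖) ≤
      2 * Real.pi * (ε / 4 * ρ + K / 2 * (1 - ρ ^ 2)) := by linarith
  have h10 := le_of_mul_le_mul_left h9 (by positivity)
  nlinarith [norm_nonneg (deriv H ρ)]

/-- Subtracting the affine function with the same value and tangential derivative at `1` reduces to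
the `o(θ)` case; `θ ↦ exp (iθ)` has derivative `i` at `0`, hence the slope `d / i`. -/
theorem tendsto_deriv_radial {G : ℂ → ℂ} (hG : DiffContOnCl ℂ G (Metric.ball 0 1)) {d : ℂ}
    (h : HasDerivAt (fun θ : ℝ => G (circleMap 0 1 θ)) d 0) :
    Tendsto (fun ρ : ℝ => deriv G ρ) (𝓝[<] 1) (𝓝 (d / Complex.I)) := by
  set c : ℂ := d / Complex.I with hc
  have hd : DiffContOnCl ℂ (fun z => c * (z - 1) + G 1) (Metric.ball 0 1) :=
    Differentiable.diffContOnCl (by fun_prop)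
  have hH : DiffContOnCl ℂ (G - fun z => c * (z - 1) + G 1) (Metric.ball 0 1) := hG.sub hd
  have hcm : HasDerivAt (circleMap 0 1) Complex.I 0 := by
    simpa [circleMap] using hasDerivAt_circleMap 0 1 0
  have h1 : HasDerivAt (fun θ : ℝ => c * (circleMap 0 1 θ - 1) + G 1) (c * Complex.I) 0 :=
    ((hcm.sub_const 1).const_mul c).add_const (G 1)
  have h2 := h.sub h1
  rw [hc, div_mul_cancel₀ _ Complex.I_ne_zero, sub_self] at h2
  have h3 := h2.isLittleO
  have h4 := tendsto_deriv_zero_of_isLittleO hH (by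
    refine h3.congr (fun θ => ?_) (fun θ => by simp)
    simp [circleMap, hc])
  have h5 : Tendsto (fun ρ : ℝ => deriv (G - fun z => c * (z - 1) + G 1) ρ + c) (𝓝[<] 1)
      (𝓝 (0 + c)) := h4.add_const c
  rw [zero_add] at h5
  refine h5.congr' ?_
  filter_upwards [Ioo_mem_nhdsLT (show (0 : ℝ) < 1 from one_pos)] with ρ hρ
  have hmem : (ρ : ℂ) ∈ Metric.ball (0 : ℂ) 1 := by simpa [abs_of_pos hρ.1] using hρ.2
  have hGd := (hG.differentiableAt Metric.isOpen_ball hmem).hasDerivAt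
  have hl : HasDerivAt (fun z : ℂ => c * (z - 1) + G 1) (c * 1) (ρ : ℂ) :=
    (((hasDerivAt_id (ρ : ℂ)).sub_const 1).const_mul c).add_const (G 1)
  rw [(hGd.sub hl).deriv]
  ring

/-- **Fatou's theorem** for the Schur class: radial limits exist almost everywhere. -/
theorem IsSchur.ae_exists_radial_limit {F : ℂ → ℂ} (hF : IsSchur F) :
    ∀ᵐ x : ℝ, ∃ l, Tendsto (fun ρ : ℝ => F (ρ * Complex.exp (2 * Real.pi * x * Complex.I)))
      (𝓝[<] 1) (𝓝 l) := by
  obtain ⟨g, hg⟩ := hF.1.isExactOn_ball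
  have hlip : LipschitzOnWith 1 g (Metric.ball 0 1) :=
    (convex_ball (0 : ℂ) 1).lipschitzOnWith_of_nnnorm_hasDerivWithin_le
      (fun z hz => (hg z hz).hasDerivWithinAt) fun z hz => hF.2 z hz
  -- The primitive lives only on the open disk; a Lipschitz extension supplies its values on the
  -- circle.
  obtain ⟨G, hGlip, hGeq⟩ := hlip.extend_finite_dimension
  have hGd : ∀ z ∈ Metric.ball (0 : ℂ) 1, HasDerivAt G (F z) z := fun z hz =>
    (hg z hz).congr_of_eventuallyEq <| by
      filter_upwards [Metric.isOpen_ball.mem_nhds hz] with w hw using (hGeq hw).symm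
  have hGdc : DiffContOnCl ℂ G (Metric.ball 0 1) :=
    ⟨fun z hz => (hGd z hz).differentiableAt.differentiableWithinAt, hGlip.continuous.continuousOn⟩
  have hl2 : LipschitzWith _ (fun x : ℝ => G (circleMap 0 1 (2 * Real.pi * x))) :=
    hGlip.comp ((lipschitzWith_circleMap 0 1).comp (lipschitzWith_smul (2 * Real.pi)))
  filter_upwards [hl2.ae_differentiableAt_real] with x hx
  set ξ : ℂ := Complex.exp (2 * Real.pi * x * Complex.I) with hξ
  have hξn : ‖ξ‖ = 1 := by
    rw [hξ]
    have := Complex.norm_exp_ofReal_mul_I (2 * Real.pi * x)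
    push_cast at this
    exact this
  have hξ0 : ξ ≠ 0 := Complex.exp_ne_zero _
  have hmaps : Set.MapsTo (fun z => ξ * z) (Metric.ball (0 : ℂ) 1) (Metric.ball 0 1) := by
    intro z hz
    simpa [hξn] using hz
  have hrot : DiffContOnCl ℂ (fun z => G (ξ * z)) (Metric.ball 0 1) :=
    hGdc.comp (Differentiable.diffContOnCl (by fun_prop)) hmaps
  have hcm : ∀ θ : ℝ, ξ * circleMap 0 1 θ =
      circleMap 0 1 (2 * Real.pi * (x + θ / (2 * Real.pi))) := by
    intro θ
    have hpi : (2 * Real.pi : ℂ) ≠ 0 := by simp [Real.pi_ne_zero]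
    simp only [circleMap, hξ, zero_add, Complex.ofReal_one, one_mul]
    rw [← Complex.exp_add]
    congr 1
    push_cast
    field_simp
  have hx' : DifferentiableAt ℝ (fun θ : ℝ => G (ξ * circleMap 0 1 θ)) 0 := by
    simp only [hcm]
    have hin : DifferentiableAt ℝ (fun θ : ℝ => x + θ / (2 * Real.pi)) 0 := by fun_prop
    refine DifferentiableAt.comp (0 : ℝ)
      (g := fun x : ℝ => G (circleMap 0 1 (2 * Real.pi * x))) ?_ hin
    simpa using hx
  have hlim := tendsto_deriv_radial hrot hx'.hasDerivAt
  refine ⟨_, (hlim.const_mul ξ⁻¹).congr' ?_⟩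
  filter_upwards [Ioo_mem_nhdsLT (show (0 : ℝ) < 1 from one_pos)] with ρ hρ
  have hmem : ξ * (ρ : ℂ) ∈ Metric.ball (0 : ℂ) 1 := by
    simpa [hξn, abs_of_pos hρ.1] using hρ.2
  have hder : HasDerivAt (fun z => G (ξ * z)) (F (ξ * ρ) * (ξ * 1)) (ρ : ℂ) :=
    (hGd _ hmem).comp (ρ : ℂ) ((hasDerivAt_id (ρ : ℂ)).const_mul ξ)
  rw [hder.deriv, mul_comm (ρ : ℂ) ξ]
  field_simp

/-! ### Fourier coefficients of boundary values -/

theorem haarAddCircle_eq_volume :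
    (AddCircle.haarAddCircle : Measure UnitAddCircle) = volume := by
  rw [AddCircle.volume_eq_smul_haarAddCircle]
  simp

theorem UnitAddCircle.ae_of_ae_real {p : UnitAddCircle → Prop}
    (h : ∀ᵐ x : ℝ, p (x : UnitAddCircle)) :
    ∀ᵐ t ∂(AddCircle.haarAddCircle : Measure UnitAddCircle), p t := by
  rw [haarAddCircle_eq_volume]
  have h1 := (AddCircle.measurePreserving_equivIoc (T := 1) (a := 0)).quasiMeasurePreserving.ae
    ((measurePreserving_subtype_coe measurableSet_Ioc).quasiMeasurePreserving.ae
      (ae_restrict_of_ae h))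
  filter_upwards [h1] with t ht
  rwa [AddCircle.coe_equivIoc] at ht

theorem IsSchur.tendsto_boundaryValue {F : ℂ → ℂ} (hF : IsSchur F) :
    ∀ᵐ t ∂(AddCircle.haarAddCircle : Measure UnitAddCircle),
      Tendsto (fun ρ : ℝ => F ((ρ : ℂ) * (AddCircle.toCircle t : ℂ))) (𝓝[<] 1)
        (𝓝 (boundaryValue F t)) := by
  refine UnitAddCircle.ae_of_ae_real ?_
  filter_upwards [hF.ae_exists_radial_limit] with x hx
  refine tendsto_nhds_limUnder ?_
  convert hx using 6
  rw [AddCircle.toCircle_apply_mk, Circle.coe_exp]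
  push_cast
  simp

theorem mul_toCircle_mem_ball {ρ : ℝ} (h0 : 0 ≤ ρ) (h1 : ρ < 1) (t : UnitAddCircle) :
    (ρ : ℂ) * (AddCircle.toCircle t : ℂ) ∈ Metric.ball (0 : ℂ) 1 := by
  rw [mem_ball_zero_iff, norm_mul, Circle.norm_coe, mul_one, Complex.norm_real, Real.norm_eq_abs,
    abs_of_nonneg h0]
  exact h1

theorem integral_fourier (m : ℤ) :
    ∫ t : UnitAddCircle, fourier m t ∂AddCircle.haarAddCircle = if m = 0 then 1 else 0 := by
  split_ifs with h
  · simp [h]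
  · exact integral_eq_zero_of_add_right_eq_neg (fourier_add_half_inv_index h one_pos)

/-- On the circle of radius `ρ < 1` the Taylor series converges absolutely and uniformly, so it is
integrated term by term and orthogonality selects one coefficient. -/
theorem IsSchur.fourierCoeff_dilate {F : ℂ → ℂ} (hF : IsSchur F) {ρ : ℝ} (h0 : 0 ≤ ρ)
    (h1 : ρ < 1) (n : ℤ) :
    fourierCoeff (fun t : UnitAddCircle => F ((ρ : ℂ) * (AddCircle.toCircle t : ℂ))) n =
      if 0 ≤ n then PowerSeries.coeff n.toNat (taylorPS F) * (ρ : ℂ) ^ n.toNat else 0 := by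
  set c : ℕ → ℂ := fun k => PowerSeries.coeff k (taylorPS F) with hc
  have hsum : ∀ z ∈ Metric.ball (0 : ℂ) 1, HasSum (fun k => c k * z ^ k) (F z) := by
    intro z hz
    have := Complex.hasSum_taylorSeries_on_ball hF.1 hz
    simp only [sub_zero, smul_eq_mul] at this
    convert! this using 2 with k
    simp only [hc, taylorPS, PowerSeries.coeff_mk]
    ring
  have hmem := mul_toCircle_mem_ball h0 h1
  have hnorm : Summable fun k => ‖c k‖ * ρ ^ k := by
    have := (hsum ρ (by simpa [abs_of_nonneg h0] using h1)).summable.norm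
    simpa [abs_of_nonneg h0] using this
  have hfou : ∀ (t : UnitAddCircle) (k : ℕ), fourier (-n) t •
      (c k * ((ρ : ℂ) * (AddCircle.toCircle t : ℂ)) ^ k) =
        c k * (ρ : ℂ) ^ k * fourier ((k : ℤ) - n) t := by
    intro t k
    rw [sub_eq_add_neg, fourier_add, smul_eq_mul, mul_pow]
    have : fourier (k : ℤ) t = (AddCircle.toCircle t : ℂ) ^ k := by
      rw [fourier_apply, AddCircle.toCircle_zsmul]
      simp
    rw [this]
    ring
  have hint := hasSum_integral_of_summable_integral_norm
    (μ := (AddCircle.haarAddCircle : Measure UnitAddCircle))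
    (F := fun (k : ℕ) (t : UnitAddCircle) => c k * (ρ : ℂ) ^ k * fourier ((k : ℤ) - n) t)
    (fun k => ((map_continuous (fourier ((k : ℤ) - n))).const_mul _).integrable_of_hasCompactSupport
      (HasCompactSupport.of_compactSpace _)) (by
        simpa only [norm_mul, fourier_apply, Circle.norm_coe, norm_pow, Complex.norm_real,
          Real.norm_eq_abs, abs_of_nonneg h0, mul_one, integral_const, probReal_univ, one_smul]
          using hnorm)
  have e1 : ∀ t : UnitAddCircle, ∑' k : ℕ, c k * (ρ : ℂ) ^ k * fourier ((k : ℤ) - n) t =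
      fourier (-n) t • F ((ρ : ℂ) * (AddCircle.toCircle t : ℂ)) := by
    intro t
    rw [← ((hsum _ (hmem t)).const_smul (fourier (-n) t)).tsum_eq]
    exact tsum_congr fun k => (hfou t k).symm
  simp only [e1, integral_const_mul, integral_fourier] at hint
  rw [fourierCoeff, ← hint.tsum_eq]
  split_ifs with hn
  · rw [tsum_eq_single n.toNat]
    · rw [if_pos (by omega), mul_one]
    · intro k hk
      rw [if_neg (by omega), mul_zero]
  · have : ∀ k : ℕ, (k : ℤ) - n ≠ 0 := fun k => by omega
    simp [this]

theorem IsSchur.continuous_dilate {F : ℂ → ℂ} (hF : IsSchur F) {ρ : ℝ} (h0 : 0 ≤ ρ)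
    (h1 : ρ < 1) :
    Continuous fun t : UnitAddCircle => F ((ρ : ℂ) * (AddCircle.toCircle t : ℂ)) := by
  refine hF.1.continuousOn.comp_continuous ?_ (mul_toCircle_mem_ball h0 h1)
  exact continuous_const.mul (continuous_subtype_val.comp AddCircle.continuous_toCircle)

theorem exists_seq_tendsto_one_left :
    ∃ u : ℕ → ℝ, (∀ j, 0 ≤ u j ∧ u j < 1) ∧ Tendsto u atTop (𝓝[<] 1) := by
  obtain ⟨u, -, hu, hlim⟩ := exists_seq_strictMono_tendsto' (show (0 : ℝ) < 1 from one_pos)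
  exact ⟨u, fun j => ⟨(hu j).1.le, (hu j).2⟩,
    tendsto_nhdsWithin_iff.2 ⟨hlim, Eventually.of_forall fun j => (hu j).2⟩⟩

theorem IsSchur.norm_boundaryValue_le {F : ℂ → ℂ} (hF : IsSchur F) :
    ∀ᵐ t ∂(AddCircle.haarAddCircle : Measure UnitAddCircle), ‖boundaryValue F t‖ ≤ 1 := by
  filter_upwards [hF.tendsto_boundaryValue] with t ht
  refine le_of_tendsto ht.norm ?_
  filter_upwards [Ioo_mem_nhdsLT (show (0 : ℝ) < 1 from one_pos)] with ρ hρ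
  exact hF.2 _ (mul_toCircle_mem_ball hρ.1.le hρ.2 t)

theorem IsSchur.integrable_boundaryValue {F : ℂ → ℂ} (hF : IsSchur F) :
    Integrable (boundaryValue F) AddCircle.haarAddCircle := by
  obtain ⟨u, hu, hlim⟩ := exists_seq_tendsto_one_left
  have hm : AEStronglyMeasurable (boundaryValue F) AddCircle.haarAddCircle :=
    aestronglyMeasurable_of_tendsto_ae atTop
      (fun j => (hF.continuous_dilate (hu j).1 (hu j).2).aestronglyMeasurable)
      (by filter_upwards [hF.tendsto_boundaryValue] with t ht using ht.comp hlim)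
  exact Integrable.of_bound hm 1 hF.norm_boundaryValue_le

theorem IsSchur.fourierCoeff_boundaryValue {F : ℂ → ℂ} (hF : IsSchur F) (n : ℤ) :
    fourierCoeff (boundaryValue F) n =
      if 0 ≤ n then PowerSeries.coeff n.toNat (taylorPS F) else 0 := by
  obtain ⟨u, hu, hlim⟩ := exists_seq_tendsto_one_left
  have h1 : Tendsto (fun j => fourierCoeff
      (fun t : UnitAddCircle => F ((u j : ℂ) * (AddCircle.toCircle t : ℂ))) n) atTop
      (𝓝 (fourierCoeff (boundaryValue F) n)) := by
    unfold fourierCoeff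
    refine tendsto_integral_of_dominated_convergence (fun _ => 1) (fun j => ?_)
      (integrable_const 1) (fun j => ?_) ?_
    · exact ((map_continuous (fourier (-n))).smul
        (hF.continuous_dilate (hu j).1 (hu j).2)).aestronglyMeasurable
    · refine Eventually.of_forall fun t => ?_
      rw [norm_smul, fourier_apply, Circle.norm_coe, one_mul]
      exact hF.2 _ (mul_toCircle_mem_ball (hu j).1 (hu j).2 t)
    · filter_upwards [hF.tendsto_boundaryValue] with t ht
      exact (ht.comp hlim).const_smul _
  refine tendsto_nhds_unique h1 ?_
  simp only [fun j => hF.fourierCoeff_dilate (hu j).1 (hu j).2 n]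
  split_ifs with hn
  · have hu1 : Tendsto (fun j => (u j : ℂ)) atTop (𝓝 1) := by
      have := (Complex.continuous_ofReal.tendsto 1).comp (hlim.mono_right nhdsWithin_le_nhds)
      simpa [Function.comp_def] using this
    simpa using (hu1.pow n.toNat).const_mul (PowerSeries.coeff n.toNat (taylorPS F))
  · exact tendsto_const_nhds

/-! ### Passage to the limit -/

theorem mainTheorem3 (F G : ℂ → ℂ) (hF : IsSzego F) (hG : IsSzego G) (r : ℝ) (hr0 : 0 < r)
    (hr1 : r < 1) (hr : 12 * Real.log (min (szegoEta F) (szegoEta G))⁻¹ ≤ 1 - r) :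
    MemWiener r (fun t => boundaryValue F t - boundaryValue G t) ∧
    wienerNorm r (fun t => boundaryValue F t - boundaryValue G t) =
      ∑' k : ℕ, r ^ k *
        ‖fourierCoeff (boundaryValue F) (k : ℤ) - fourierCoeff (boundaryValue G) (k : ℤ)‖ ∧
    (Summable fun k : ℕ => r ^ k * ‖recCoeff F k - recCoeff G k‖) ∧
    (1 / 2 : ℝ) * recDist r F G ≤
      wienerNorm r (fun t => boundaryValue F t - boundaryValue G t) ∧
    wienerNorm r (fun t => boundaryValue F t - boundaryValue G t) ≤ 2 * recDist r F G := by
  have hFs := hF.1.1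
  have hGs := hG.1.1
  have hFi := hFs.integrable_boundaryValue
  have hGi := hGs.integrable_boundaryValue
  have hm0 : 0 < min (szegoEta F) (szegoEta G) := lt_min hF.2 hG.2
  have hFa : ∀ k, ‖recCoeff F k‖ < 1 := fun k => (isSchur_schurIter hFs hF.2 k).2
  have hGa : ∀ k, ‖recCoeff G k‖ < 1 := fun k => (isSchur_schurIter hGs hG.2 k).2
  have hFsm := isSmallSeq_recCoeff hF.2 hFa hm0 (min_le_left _ _) hr
  have hGsm := isSmallSeq_recCoeff hG.2 hGa hm0 (min_le_right _ _) hr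
  have hFc := isSchurChain_taylorPS hFs hF.2
  have hGc := isSchurChain_taylorPS hGs hG.2
  have hcoef : ∀ n : ℤ, fourierCoeff (fun t => boundaryValue F t - boundaryValue G t) n =
      fourierCoeff (boundaryValue F) n - fourierCoeff (boundaryValue G) n := by
    intro n
    simp only [fourierCoeff, smul_sub]
    exact integral_sub (hFi.fourier_smul _) (hGi.fourier_smul _)
  have hneg : ∀ n : ℤ, ¬ 0 ≤ n →
      fourierCoeff (fun t => boundaryValue F t - boundaryValue G t) n = 0 := by
    intro n hn
    rw [hcoef, hFs.fourierCoeff_boundaryValue, hGs.fourierCoeff_boundaryValue, if_neg hn,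
      if_neg hn, sub_zero]
  set d : ℕ → ℝ := fun k => r ^ k *
    ‖fourierCoeff (boundaryValue F) (k : ℤ) - fourierCoeff (boundaryValue G) (k : ℤ)‖ with hd
  have hpartial : ∀ n, ∑ k ∈ Finset.range n, d k = truncNorm r n (taylorPS F - taylorPS G) := by
    intro n
    refine Finset.sum_congr rfl fun k _ => ?_
    rw [hd, map_sub]
    simp only [hFs.fourierCoeff_boundaryValue, hGs.fourierCoeff_boundaryValue,
      Int.natCast_nonneg, if_true, Int.toNat_natCast]
  -- All coefficients have modulus below one, so a geometric series dominates.
  have hes : Summable fun k : ℕ => r ^ k * ‖recCoeff F k - recCoeff G k‖ := by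
    refine Summable.of_nonneg_of_le (fun k => by positivity) (fun k => ?_)
      ((summable_geometric_of_lt_one hr0.le hr1).mul_right 2)
    refine mul_le_mul_of_nonneg_left ?_ (by positivity)
    linarith [norm_sub_le (recCoeff F k) (recCoeff G k), hFa k, hGa k]
  have hup : ∀ n, ∑ k ∈ Finset.range n, d k ≤
      2 * ∑ k ∈ Finset.range n, r ^ k * ‖recCoeff F k - recCoeff G k‖ := fun n =>
    (hpartial n).trans_le (hFc.truncNorm_sub_le hr0.le hr1 hGc hFsm hGsm n)
  have hlow : ∀ n, 1 / 2 * ∑ k ∈ Finset.range n, r ^ k * ‖recCoeff F k - recCoeff G k‖ ≤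
      ∑ k ∈ Finset.range n, d k := fun n =>
    (hFc.le_truncNorm_sub hr0.le hr1 hGc hFsm hGsm n).trans_eq (hpartial n).symm
  -- Convergence is itself a consequence of the truncated upper estimate, whose right side is
  -- bounded in `n`.
  have hds : Summable d := by
    refine summable_of_sum_range_le (c := 2 * recDist r F G) (fun k => by positivity) fun n => ?_
    refine (hup n).trans (mul_le_mul_of_nonneg_left ?_ zero_le_two)
    exact hes.sum_le_tsum _ fun k _ => by positivity
  have hinj : Function.Injective (Nat.cast : ℕ → ℤ) := Nat.cast_injective
  have hzero : ∀ n ∉ Set.range (Nat.cast : ℕ → ℤ),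
      r ^ n * ‖fourierCoeff (fun t => boundaryValue F t - boundaryValue G t) n‖ = 0 := by
    intro n hn
    rw [hneg n fun h => hn ⟨n.toNat, Int.toNat_of_nonneg h⟩, norm_zero, mul_zero]
  have hcomp : ∀ k : ℕ, r ^ (k : ℤ) *
      ‖fourierCoeff (fun t => boundaryValue F t - boundaryValue G t) (k : ℤ)‖ = d k := by
    intro k
    rw [hcoef, zpow_natCast]
  have hW : wienerNorm r (fun t => boundaryValue F t - boundaryValue G t) = ∑' k, d k := by
    rw [wienerNorm, ← hinj.tsum_eq]
    · exact tsum_congr hcomp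
    · intro n hn
      by_contra h
      exact hn (hzero n h)
  refine ⟨⟨hFi.sub hGi, ?_⟩, hW, hes, ?_, ?_⟩
  · rw [← hinj.summable_iff hzero]
    exact hds.congr fun k => (hcomp k).symm
  · rw [hW]
    exact le_of_tendsto_of_tendsto' (hes.tendsto_sum_tsum_nat.const_mul _)
      hds.tendsto_sum_tsum_nat hlow
  · rw [hW]
    exact le_of_tendsto_of_tendsto' hds.tendsto_sum_tsum_nat
      (hes.tendsto_sum_tsum_nat.const_mul _) hup
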